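/- Let $(E,\mathcal E)$ be a measurable space, $w:E\to[1,+\infty)$ a measurable function, and let $\mathcal B_w$ be the space of complex measurable functions $f$ on $E$ with $\|f\|_w=\sup_E w^{-1}|f|<\infty$; let $\mathcal B$ be the space of bounded complex measurable functions on $E$. A kernel $Q$ acts on $\mathcal B_w$ by $Qf(x)=\int f(y)\,Q(x,dy)$ when $w^{-1}(Qw)$ is bounded. For a bounded operator $Q$ with spectral radius $r(Q)$ on a Banach space, the essential spectral radius $r_e(Q)$ is the infimum of $r(Q)$ and of the real numbers $\rho\ge 0$ such that the space is a direct sum $F\oplus H$ of $Q$-invariant subspaces with $H$ closed, $r(Q|_H)<\rho$, $\dim F<\infty$, and all eigenvalues of $Q|_F$ of modulus $\ge\rho$; $Q$ is quasi-compact if $r_e(Q)<r(Q)$. **Ergodic theorem.** Let $P$ be a Markov kernel on $(E,\mathcal E)$ which acts on $\mathcal B_w$ as a quasi-compact operator. Then there exist an integer $d\ge 1$, a finite-rank Markov kernel $S$ acting on $\mathcal B_w$ with $S(\mathcal B_w)\subset\mathcal B$, and constants $C$ and $0\le\rho<1$, such that for all $k=0,\dots,d-1$ and all $n\ge 0$ $$\|P^{nd+k}-P^kS\|_w\le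 C\rho^n,$$ that is, for all $f\in\mathcal B_w$ and $x\in E$, $|P^{nd+k}f(x)-P^kSf(x)|\le C\|f\|_w\,\rho^n\,w(x)$. If moreover $P$ is irreducible and aperiodic, then these hold with $d=1$ and $Sf=\pi(f)1_E$ for $f\in\mathcal B_w$ (each such $f$ being $\pi$-integrable), where $\pi$ is the unique $P$-invariant probability distribution. Here $P$ is irreducible if it has an irreducibility measure, i.e. a non-zero measure $\varphi$ on $(E,\mathcal E)$ such that for all $A\in\mathcal E$ with $\varphi(A)>0$ and all $x\in E$ there is $n$ with $P^n(x,A)>0$. An irreducible $P$ is aperiodic if $d=1$ is the only integer $d\ge1$ for which there are disjoint sets $D_i\in\mathcal E$, $i\in\mathbb Z/d\mathbb Z$, with $P(x,D_{i+1})=1$ for $x\in D_i$ and $\varphi\big((\bigcup_iD_i)^c\big)=0$ for every irreducibility measure $\varphi$. -/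

import Mathlib

open MeasureTheory ProbabilityTheory
open scoped ENNReal NNReal

namespace QuasiCompactKernel

/-! ### Essential spectral radius and quasi-compact operators -/

section Operators

variable {B : Type*} [NormedAddCommGroup B] [NormedSpace ℂ B]

/-- `B = F ⊕ H` with `F`, `H` invariant under `Q`, `H` closed, `r(Q|_H) < ρ`, `dim F < ∞`, and
all eigenvalues of `Q|_F` of modulus at least `ρ`. -/
def HasSpectralSplitting (Q : B →L[ℂ] B) (ρ : ℝ≥0) : Prop :=
  ∃ (F H : Submodule ℂ B) (hF : Set.MapsTo Q F F) (hH : Set.MapsTo Q H H),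
    IsCompl F H ∧ IsClosed (H : Set B) ∧
    spectralRadius ℂ (Q.restrict hH) < (ρ : ℝ≥0∞) ∧
    FiniteDimensional ℂ F ∧
    ∀ μ : ℂ, Module.End.HasEigenvalue ((Q.restrict hF : F →L[ℂ] F) : F →ₗ[ℂ] F) μ →
      (ρ : ℝ) ≤ ‖μ‖

/-- The essential spectral radius: the infimum of `r(Q)` and of the numbers `ρ ≥ 0` for which
`Q` has a spectral splitting at level `ρ`. -/
noncomputable def essSpectralRadius (Q : B →L[ℂ] B) : ℝ≥0∞ :=
  sInf ({spectralRadius ℂ Q} ∪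
    {r : ℝ≥0∞ | ∃ ρ : ℝ≥0, r = (ρ : ℝ≥0∞) ∧ HasSpectralSplitting Q ρ})

/-- `Q` is quasi-compact when `r_e(Q) < r(Q)`. -/
def IsQuasiCompact (Q : B →L[ℂ] B) : Prop :=
  essSpectralRadius Q < spectralRadius ℂ Q

end Operators

/-! ### The space of measurable functions bounded with respect to a weight -/

/-- A measurable function `w : E → [1, +∞[`. -/
structure Weight (E : Type*) [MeasurableSpace E] where
  toFun : E → ℝ
  measurable' : Measurable toFun
  one_le' : ∀ x, 1 ≤ toFun x

variable {E : Type*} [MeasurableSpace E]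

instance : CoeFun (Weight E) (fun _ => E → ℝ) := ⟨Weight.toFun⟩

theorem Weight.pos (w : Weight E) (x : E) : 0 < w x := lt_of_lt_of_le one_pos (w.one_le' x)

/-- The complex measurable functions `f` on `E` with `sup_E |f| / w < ∞`. -/
def weightedSubmodule (w : Weight E) : Submodule ℂ (E → ℂ) where
  carrier := {f | Measurable f ∧ BddAbove (Set.range fun x => ‖f x‖ / w x)}
  zero_mem' := ⟨measurable_const, 0, by rintro _ ⟨x, rfl⟩; simp⟩
  add_mem' := by
    rintro f g ⟨hf, a, ha⟩ ⟨hg, b, hb⟩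
    refine ⟨hf.add hg, a + b, ?_⟩
    rintro _ ⟨x, rfl⟩
    have h1 := ha ⟨x, rfl⟩
    have h2 := hb ⟨x, rfl⟩
    have h3 : ‖(f + g) x‖ / w x ≤ ‖f x‖ / w x + ‖g x‖ / w x := by
      rw [← add_div]
      exact div_le_div_of_nonneg_right (norm_add_le _ _) (w.pos x).le
    exact h3.trans (add_le_add h1 h2)
  smul_mem' := by
    rintro c f ⟨hf, a, ha⟩
    refine ⟨hf.const_smul c, ‖c‖ * a, ?_⟩
    rintro _ ⟨x, rfl⟩
    have h1 := mul_le_mul_of_nonneg_left (ha ⟨x, rfl⟩) (norm_nonneg c)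
    simpa [mul_div_assoc] using h1

/-- The space `𝓑_w`; a type synonym, so that it carries only the topology of the norm below. -/
def WBounded (w : Weight E) : Type _ := weightedSubmodule w

namespace WBounded

variable {w : Weight E}

noncomputable instance : AddCommGroup (WBounded w) :=
  inferInstanceAs (AddCommGroup (weightedSubmodule w))

noncomputable instance : Module ℂ (WBounded w) :=
  inferInstanceAs (Module ℂ (weightedSubmodule w))

instance : CoeFun (WBounded w) (fun _ => E → ℂ) := ⟨fun f => f.1⟩

theorem ext {f g : WBounded w} (h : ∀ x, f x = g x) : f = g := Subtype.ext (funext h)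

theorem measurable (f : WBounded w) : Measurable (f : E → ℂ) := f.2.1

theorem add_apply (f g : WBounded w) (x : E) : (f + g) x = f x + g x := rfl

theorem smul_apply (c : ℂ) (f : WBounded w) (x : E) : (c • f) x = c * f x := rfl

/-- `‖f‖_w = sup_E |f| / w`. -/
noncomputable instance : Norm (WBounded w) := ⟨fun f => ⨆ x, ‖f x‖ / w x⟩

theorem norm_def (f : WBounded w) : ‖f‖ = ⨆ x, ‖f x‖ / w x := rfl

theorem norm_apply_le (f : WBounded w) (x : E) : ‖f x‖ ≤ ‖f‖ * w x := by
  rw [← div_le_iff₀ (w.pos x)]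
  exact le_ciSup f.2.2 x

theorem norm_nonneg' (f : WBounded w) : 0 ≤ ‖f‖ :=
  Real.iSup_nonneg fun x => div_nonneg (norm_nonneg _) (w.pos x).le

theorem norm_le_of_forall {f : WBounded w} {M : ℝ} (hM : 0 ≤ M)
    (h : ∀ x, ‖f x‖ ≤ M * w x) : ‖f‖ ≤ M :=
  Real.iSup_le (fun x => (div_le_iff₀ (w.pos x)).2 (h x)) hM

theorem normedSpaceCore : NormedSpace.Core ℂ (WBounded w) where
  norm_nonneg := norm_nonneg'
  norm_smul c f := by
    rw [norm_def, norm_def, Real.mul_iSup_of_nonneg (norm_nonneg c)]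
    refine iSup_congr fun x => ?_
    rw [smul_apply, norm_mul, mul_div_assoc]
  norm_triangle f g := by
    refine norm_le_of_forall (add_nonneg (norm_nonneg' f) (norm_nonneg' g)) fun x => ?_
    rw [add_apply, add_mul]
    exact (norm_add_le _ _).trans (add_le_add (norm_apply_le f x) (norm_apply_le g x))
  norm_eq_zero_iff f := by
    constructor
    · intro h
      refine ext fun x => ?_
      have := norm_apply_le f x
      rw [h, zero_mul] at this
      exact norm_le_zero_iff.1 this
    · rintro rfl
      exact le_antisymm (norm_le_of_forall le_rfl fun x => by
        rw [zero_mul]; exact (norm_zero (E := ℂ)).le) (norm_nonneg' _)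

noncomputable instance : NormedAddCommGroup (WBounded w) :=
  NormedAddCommGroup.ofCore normedSpaceCore

noncomputable instance : NormedSpace ℂ (WBounded w) :=
  NormedSpace.ofCore normedSpaceCore

end WBounded

/-! ### Kernels acting on `𝓑_w` -/

/-- The kernel `Q` acts on `𝓑_w`: the function `w⁻¹ (Q w)` is bounded. -/
def ActsOn (Q : Kernel E E) (w : Weight E) : Prop :=
  ∃ K : ℝ≥0, ∀ x, ∫⁻ y, ENNReal.ofReal (w y) ∂(Q x) ≤ K * ENNReal.ofReal (w x)

theorem ActsOn.integrable_weight {Q : Kernel E E} {w : Weight E} (h : ActsOn Q w) (x : E) :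
    Integrable w (Q x) := by
  obtain ⟨K, hK⟩ := h
  refine ⟨w.measurable'.aestronglyMeasurable, ?_⟩
  rw [hasFiniteIntegral_iff_ofReal (Filter.Eventually.of_forall fun y => (w.pos y).le)]
  exact (hK x).trans_lt (ENNReal.mul_lt_top ENNReal.coe_lt_top ENNReal.ofReal_lt_top)

theorem ActsOn.integrable {Q : Kernel E E} {w : Weight E} (h : ActsOn Q w) (f : WBounded w)
    (x : E) : Integrable (f : E → ℂ) (Q x) :=
  ((h.integrable_weight x).const_mul ‖f‖).mono' f.measurable.aestronglyMeasurable
    (Filter.Eventually.of_forall fun y => WBounded.norm_apply_le f y)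

theorem ActsOn.exists_bound {Q : Kernel E E} {w : Weight E} (h : ActsOn Q w) :
    ∃ K : ℝ, 0 ≤ K ∧ ∀ (f : WBounded w) (x : E), ‖∫ y, f y ∂(Q x)‖ ≤ K * ‖f‖ * w x := by
  obtain ⟨K, hK⟩ := id h
  refine ⟨K, K.2, fun f x => ?_⟩
  have h1 : ∫ y, w y ∂(Q x) ≤ K * w x := by
    rw [integral_eq_lintegral_of_nonneg_ae
      (Filter.Eventually.of_forall fun y => (w.pos y).le) w.measurable'.aestronglyMeasurable]
    refine (ENNReal.toReal_mono (ENNReal.mul_ne_top ENNReal.coe_ne_top ENNReal.ofReal_ne_top)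
      (hK x)).trans_eq ?_
    rw [ENNReal.toReal_mul, ENNReal.coe_toReal, ENNReal.toReal_ofReal (w.pos x).le]
  calc ‖∫ y, f y ∂(Q x)‖ ≤ ∫ y, ‖f‖ * w y ∂(Q x) :=
        norm_integral_le_of_norm_le ((h.integrable_weight x).const_mul ‖f‖)
          (Filter.Eventually.of_forall fun y => WBounded.norm_apply_le f y)
    _ = ‖f‖ * ∫ y, w y ∂(Q x) := integral_const_mul _ _
    _ ≤ ‖f‖ * (K * w x) := mul_le_mul_of_nonneg_left h1 (norm_nonneg f)
    _ = K * ‖f‖ * w x := by ring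

/-- The bounded operator `(Qf)(x) = ∫ f(y) Q(x, dy)` on `𝓑_w` defined by a kernel acting on it. -/
noncomputable def kernelOp (Q : Kernel E E) (w : Weight E) (h : ActsOn Q w) :
    WBounded w →L[ℂ] WBounded w :=
  LinearMap.mkContinuousOfExistsBound
    { toFun := fun f => ⟨fun x => ∫ y, f y ∂(Q x), by
        obtain ⟨K, -, hK⟩ := h.exists_bound
        refine ⟨(f.measurable.stronglyMeasurable.integral_kernel).measurable, K * ‖f‖, ?_⟩
        rintro _ ⟨x, rfl⟩
        exact (div_le_iff₀ (w.pos x)).2 (hK f x)⟩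
      map_add' := fun f g => WBounded.ext fun x =>
        integral_add (h.integrable f x) (h.integrable g x)
      map_smul' := fun c f => WBounded.ext fun x => integral_const_mul c _ }
    (by
      obtain ⟨K, hK0, hK⟩ := h.exists_bound
      exact ⟨K, fun f => WBounded.norm_le_of_forall (mul_nonneg hK0 (norm_nonneg f)) (hK f)⟩)

theorem kernelOp_apply (Q : Kernel E E) (w : Weight E) (h : ActsOn Q w) (f : WBounded w) (x : E) :
    kernelOp Q w h f x = ∫ y, f y ∂(Q x) := rfl

/-! ### Irreducible and aperiodic Markov kernels -/

/-- `φ` is an irreducibility measure of `P`: it is non-zero, and every measurable set of positive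
`φ`-measure can be reached with positive probability from every point. -/
def IsIrreducibilityMeasure (P : Kernel E E) (φ : Measure E) : Prop :=
  φ ≠ 0 ∧ Kernel.IsIrreducible φ P

/-- `P` is (`φ`-)irreducible for some `φ`. -/
def IsIrreducibleKernel (P : Kernel E E) : Prop :=
  ∃ φ : Measure E, IsIrreducibilityMeasure P φ

/-- A `d`-cycle of `P`: disjoint measurable sets `D i`, indexed by the integers modulo `d`, with
`P(x, D (i + 1)) = 1` for `x ∈ D i`, whose union has a complement that is null for every
irreducibility measure (equivalently, for a maximal one). -/
def IsCycle (P : Kernel E E) (d : ℕ) (D : ZMod d → Set E) : Prop :=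
  (∀ i, MeasurableSet (D i)) ∧
  (∀ i j, i ≠ j → Disjoint (D i) (D j)) ∧
  (∀ i, ∀ x ∈ D i, P x (D (i + 1)) = 1) ∧
  ∀ φ : Measure E, IsIrreducibilityMeasure P φ → φ (⋃ i, D i)ᶜ = 0

/-- An irreducible kernel `P` is aperiodic when its only `d`-cycles, `d ≥ 1`, are those with
`d = 1`. -/
def IsAperiodicKernel (P : Kernel E E) : Prop :=
  ∀ d : ℕ, 1 ≤ d → (∃ D : ZMod d → Set E, IsCycle P d D) → d = 1

end QuasiCompactKernel

/-! Let `T` be the operator of `P`, split at a level ρ < r(T), with projection `p` onto the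
finite-dimensional part `F`; off `F` the powers decay like rⁿ, r < ρ. The weight gives no control on
the growth of `T ^ n`, but bounded functions do, since averages do not increase the supremum.
`exists_bounded_projection_eq` shows that `p f` always equals `p g` for some bounded `g`. So orbits
in `F` are bounded, which forces ρ ≤ 1, hence r < 1, and Banach–Steinhaus makes `T` power-bounded.

The powers of `T` then stay in a compact set of operators. Their cluster points form a compact
semigroup, which contains an idempotent `L` of finite rank. As a limit of powers of `T`, `L` is
positive, fixes constants and respects bounded pointwise limits, so it is the operator of a Markov
kernel `S`. Along a subsequence `T ^ φ j * (1 - L)` tends to 0, so `T * (1 - L)` has spectral radius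
below 1 and Tⁿ - TⁿL decays geometrically.

It remains to see that `T` has finite order on the range of `L`. Power-boundedness excludes Jordan
blocks, so it suffices that the eigenvalues there are roots of unity. If Tf = μf with |μ| = 1 and
`f` bounded, then |f|² is subharmonic and its defect T|f|² - |f|² is a conditional variance which
`L` annihilates. Hence, on an absorbing set of full measure for every `S x`, one step of the chain
multiplies `f` by μ almost surely. Powers of `f` thus produce eigenvalues μᵏ for every k, and there
are only finitely many eigenvalues.

The level sets of such an `f` form a cycle whose length is the order of μ, so aperiodicity gives μ =
1. Level sets of a harmonic `f` are absorbing, so irreducibility makes `f` constant, and `S x` does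
not depend on `x`. -/

open Filter Topology

namespace QuasiCompactKernel

/-! ### Spectral radius and spectral splittings -/

section Operators

/-- Geometric decay of the powers of an element at any rate above the spectral radius. -/
theorem exists_norm_pow_le_of_spectralRadius_lt {A : Type*} [NormedRing A] [NormedAlgebra ℂ A]
    [CompleteSpace A] (a : A) {ρ : ℝ≥0} (h : spectralRadius ℂ a < ρ) :
    ∃ r : ℝ, 0 < r ∧ r < ρ ∧ ∃ C : ℝ, ∀ n, ‖a ^ n‖ ≤ C * r ^ n := by
  obtain ⟨s, hs1, hs2⟩ := ENNReal.lt_iff_exists_nnreal_btwn.1 h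
  have hev := (spectrum.pow_nnnorm_pow_one_div_tendsto_nhds_spectralRadius a).eventually_lt_const
    hs1
  have hs0 : (0 : ℝ) < s := by
    have : (0 : ℝ≥0∞) < s := pos_of_gt hs1
    exact_mod_cast this
  refine ⟨s, hs0, by exact_mod_cast hs2, ?_⟩
  obtain ⟨N, hN⟩ := eventually_atTop.1 hev
  have key : ∀ n ≥ N + 1, ‖a ^ n‖ ≤ (s : ℝ) ^ n := by
    intro n hn
    have hn0 : (n : ℝ) ≠ 0 := by
      have : n ≠ 0 := by omega
      exact_mod_cast this
    have h2 := ENNReal.rpow_le_rpow (hN n (by omega)).le (Nat.cast_nonneg (α := ℝ) n)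
    rw [← ENNReal.rpow_mul, one_div, inv_mul_cancel₀ hn0, ENNReal.rpow_one,
      ENNReal.rpow_natCast] at h2
    exact_mod_cast h2
  -- The 1 serves the large exponents, the sum the finitely many others.
  refine ⟨1 + ∑ k ∈ Finset.range (N + 1), ‖a ^ k‖ / s ^ k, fun n => ?_⟩
  have hsum : 0 ≤ ∑ k ∈ Finset.range (N + 1), ‖a ^ k‖ / (s : ℝ) ^ k :=
    Finset.sum_nonneg fun k _ => by positivity
  rw [← div_le_iff₀ (pow_pos hs0 n)]
  by_cases hn : N + 1 ≤ n
  · exact ((div_le_one (pow_pos hs0 n)).2 (key n hn)).trans (by linarith)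
  · have := Finset.single_le_sum (f := fun k => ‖a ^ k‖ / (s : ℝ) ^ k)
      (fun k _ => by positivity) (Finset.mem_range.2 (not_le.1 hn))
    linarith

theorem exists_opNorm_pow_le_of_spectralRadius_lt {X : Type*} [NormedAddCommGroup X]
    [NormedSpace ℂ X] [CompleteSpace X] (R : X →L[ℂ] X) {ρ : ℝ≥0} (h : spectralRadius ℂ R < ρ) :
    ∃ r : ℝ, 0 < r ∧ r < ρ ∧ ∃ C : ℝ, ∀ n, ‖R ^ n‖ ≤ C * r ^ n :=
  exists_norm_pow_le_of_spectralRadius_lt R h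

/-- The spectral radius is at most any geometric rate of growth of the powers. -/
theorem spectralRadius_le_of_norm_pow_le {A : Type*} [NormedRing A] [NormedAlgebra ℂ A]
    [CompleteSpace A] (a : A) {C r : ℝ} (hr : 0 < r) (h : ∀ n, ‖a ^ n‖ ≤ C * r ^ n) :
    spectralRadius ℂ a ≤ ENNReal.ofReal r := by
  have hC : 0 ≤ C := by simpa using (norm_nonneg _).trans (h 0)
  -- With `C + 1` in place of `C` the base is positive, so its n-th root tends to 1.
  have hlim : Tendsto (fun n : ℕ => ENNReal.ofReal ((C + 1) ^ (1 / n : ℝ) * r)) atTop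
      (𝓝 (ENNReal.ofReal r)) := by
    refine (ENNReal.continuous_ofReal.tendsto _).comp ?_
    have h1 : Tendsto (fun n : ℕ => (C + 1) ^ (1 / n : ℝ)) atTop (𝓝 1) := by
      have := (Real.continuousAt_const_rpow (a := C + 1) (b := 0) (by positivity)).tendsto.comp
        tendsto_one_div_atTop_nhds_zero_nat
      simpa [Function.comp_def] using this
    simpa using h1.mul_const r
  refine le_of_tendsto_of_tendsto
    (spectrum.pow_nnnorm_pow_one_div_tendsto_nhds_spectralRadius a) hlim ?_
  filter_upwards [eventually_gt_atTop 0] with n hn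
  have hn0 : (n : ℝ) ≠ 0 := by exact_mod_cast hn.ne'
  have h1 : (‖a ^ n‖₊ : ℝ≥0∞) ≤ ENNReal.ofReal ((C + 1) * r ^ n) := by
    rw [← enorm_eq_nnnorm, ← ofReal_norm]
    exact ENNReal.ofReal_le_ofReal ((h n).trans (by gcongr; linarith))
  refine (ENNReal.rpow_le_rpow h1 (by positivity)).trans_eq ?_
  rw [ENNReal.ofReal_rpow_of_nonneg (by positivity) (by positivity),
    Real.mul_rpow (by positivity) (by positivity), ← Real.rpow_natCast r n, ← Real.rpow_mul hr.le,
    mul_one_div_cancel hn0, Real.rpow_one]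

variable {B : Type*} [NormedAddCommGroup B] [NormedSpace ℂ B]

/-- A spectral splitting in terms of the projection onto the finite-dimensional part. -/
theorem HasSpectralSplitting.exists_projection [CompleteSpace B] {Q : B →L[ℂ] B} {ρ : ℝ≥0}
    (h : HasSpectralSplitting Q ρ) :
    ∃ (F : Submodule ℂ B) (p : B →L[ℂ] B) (C r : ℝ), FiniteDimensional ℂ F ∧ 0 < r ∧ r < ρ ∧
      (∀ x, p x ∈ F) ∧ (∀ x ∈ F, p x = x) ∧ Q * p = p * Q ∧ (∀ x ∈ F, Q x ∈ F) ∧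
      (∀ n, ‖Q ^ n * (1 - p)‖ ≤ C * r ^ n) ∧
      ∀ (μ : ℂ), ∀ v ∈ F, v ≠ 0 → Q v = μ • v → (ρ : ℝ) ≤ ‖μ‖ := by
  obtain ⟨F, H, hF, hH, hFH, hHc, hrad, hfin, hev⟩ := h
  have : CompleteSpace H := hHc.completeSpace_coe
  obtain ⟨R, hR⟩ : ∃ R : H →L[ℂ] H, R = Q.restrict hH := ⟨_, rfl⟩
  rw [← hR] at hrad
  have hRQ : ∀ y : H, Q y = R y := fun y => by rw [hR]; rfl
  obtain ⟨r, hr0, hrρ, C, hC⟩ :=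
    exists_opNorm_pow_le_of_spectralRadius_lt R hrad
  have hFc : IsClosed (F : Set B) := F.closed_of_finiteDimensional
  obtain ⟨p, q, hpF, hp1, hp0, hpq⟩ : ∃ (p : B →L[ℂ] B) (q : B →L[ℂ] H), (∀ x, p x ∈ F) ∧
      (∀ x ∈ F, p x = x) ∧ (∀ x ∈ H, p x = 0) ∧ ∀ x, p x + q x = x := by
    have htop : Submodule.IsTopCompl F H :=
      Submodule.IsCompl.isTopCompl_of_isClosed hFH hFc hHc
    refine ⟨F.projectionL H htop, H.projectionOntoL F htop.symm,
      Submodule.projectionL_apply_mem htop,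
      fun x hx => Submodule.projectionL_apply_left htop ⟨x, hx⟩,
      fun x hx => Submodule.projectionL_apply_right htop ⟨x, hx⟩, fun x => ?_⟩
    rw [Submodule.coe_projectionOntoL_apply]
    exact DFunLike.congr_fun (Submodule.projectionL_add_projectionL_eq_id htop) x
  have hcomm : ∀ x, Q (p x) = p (Q x) := fun x => by
    conv_rhs => rw [← hpq x, map_add, map_add, hp1 _ (hF (hpF x)), hp0 _ (hH (q x).2), add_zero]
  have hpow : ∀ n (y : H), (Q ^ n) (y : B) = ((R ^ n) y : B) := by
    intro n
    induction n with
    | zero => intro y; rfl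
    | succ n ih =>
      intro y
      rw [pow_succ, pow_succ, mul_apply_eq_comp, mul_apply_eq_comp, hRQ, ih]
  refine ⟨F, p, C * ‖q‖, r, hfin, hr0, hrρ, hpF, hp1, ContinuousLinearMap.ext hcomm, hF, fun n => ?_, ?_⟩
  · have hC0 : 0 ≤ C := by simpa using (norm_nonneg _).trans (hC 0)
    refine ContinuousLinearMap.opNorm_le_bound _ (by positivity) fun x => ?_
    have h1 : (Q ^ n * (1 - p)) x = ((R ^ n) (q x) : B) := by
      rw [← hpow]
      change (Q ^ n) (x - p x) = (Q ^ n) (q x)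
      rw [sub_eq_of_eq_add' (hpq x).symm]
    rw [h1]
    calc ‖((R ^ n) (q x) : B)‖ ≤ ‖R ^ n‖ * ‖q x‖ :=
          (R ^ n).le_opNorm (q x)
      _ ≤ (C * r ^ n) * (‖q‖ * ‖x‖) := by
          gcongr
          · exact hC n
          · exact q.le_opNorm x
      _ = C * ‖q‖ * r ^ n * ‖x‖ := by ring
  · intro μ v hv hv0 hμ
    refine hev μ (Module.End.hasEigenvalue_of_hasEigenvector (x := ⟨v, hv⟩)
      ⟨Module.End.mem_eigenspace_iff.2 (Subtype.ext hμ), ?_⟩)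
    exact fun h => hv0 (congrArg Subtype.val h)

/-- On an invariant finite-dimensional subspace whose eigenvalues have modulus at least `ρ`, no
non-zero vector decays at a rate `r < ρ`. -/
theorem eq_zero_of_norm_pow_le {Q : B →L[ℂ] B} {F : Submodule ℂ B} [FiniteDimensional ℂ F]
    {r ρ : ℝ} (hr : 0 < r) (hrρ : r < ρ) (hF : ∀ x ∈ F, Q x ∈ F)
    (hev : ∀ (μ : ℂ), ∀ v ∈ F, v ≠ 0 → Q v = μ • v → ρ ≤ ‖μ‖)
    {u : B} (hu : u ∈ F) {C : ℝ} (hC : ∀ n, ‖(Q ^ n) u‖ ≤ C * r ^ n) : u = 0 := by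
  -- The vectors of `F` decaying at rate `r` form an invariant subspace. If it were non-zero it
  -- would contain an eigenvector, whose eigenvalue has modulus at least `ρ > r`, against the decay.
  let W : Submodule ℂ B :=
    { carrier := {v | v ∈ F ∧ ∃ C : ℝ, ∀ n, ‖(Q ^ n) v‖ ≤ C * r ^ n}
      zero_mem' := ⟨F.zero_mem, 0, by simp⟩
      add_mem' := by
        rintro a b ⟨ha, Ca, hCa⟩ ⟨hb, Cb, hCb⟩
        refine ⟨F.add_mem ha hb, Ca + Cb, fun n => ?_⟩
        rw [map_add, add_mul]
        exact (norm_add_le _ _).trans (add_le_add (hCa n) (hCb n))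
      smul_mem' := by
        rintro c a ⟨ha, Ca, hCa⟩
        refine ⟨F.smul_mem c ha, ‖c‖ * Ca, fun n => ?_⟩
        rw [map_smul, norm_smul, mul_assoc]
        exact mul_le_mul_of_nonneg_left (hCa n) (norm_nonneg c) }
  have hWF : W ≤ F := fun v hv => hv.1
  have hQW : ∀ v ∈ W, Q v ∈ W := by
    rintro v ⟨hv, Cv, hCv⟩
    refine ⟨hF v hv, Cv * r, fun n => ?_⟩
    have := hCv (n + 1)
    rw [pow_succ] at this
    refine (le_of_eq rfl).trans (this.trans_eq (by ring))
  have : FiniteDimensional ℂ W := Submodule.finiteDimensional_of_le hWF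
  by_contra hu0
  have : Nontrivial W := ⟨⟨⟨u, hu, C, hC⟩, 0, fun h => hu0 (congrArg Subtype.val h)⟩⟩
  obtain ⟨μ, hμ⟩ := Module.End.exists_eigenvalue ((Q : B →ₗ[ℂ] B).restrict hQW)
  obtain ⟨v, hv⟩ := hμ.exists_hasEigenvector
  have hv0 : (v : B) ≠ 0 := fun h => hv.2 (Subtype.ext h)
  have hQv : Q v = μ • (v : B) := congrArg Subtype.val (Module.End.mem_eigenspace_iff.1 hv.1)
  have hμρ := hev μ v (hWF v.2) hv0 hQv
  have hpow : ∀ n, (Q ^ n) (v : B) = μ ^ n • (v : B) := by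
    intro n
    induction n with
    | zero => simp
    | succ n ih =>
      rw [pow_succ, mul_apply_eq_comp, hQv, map_smul, ih, smul_smul, pow_succ']
  obtain ⟨Cv, hCv⟩ := v.2.2
  have hv0' : 0 < ‖(v : B)‖ := norm_pos_iff.2 hv0
  have hle : ∀ n : ℕ, (‖μ‖ / r) ^ n ≤ Cv / ‖(v : B)‖ := fun n => by
    have := hCv n
    rw [hpow, norm_smul, norm_pow] at this
    rw [div_pow, div_le_div_iff₀ (by positivity) hv0']
    exact this
  obtain ⟨n, hn⟩ := pow_unbounded_of_one_lt (Cv / ‖(v : B)‖)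
    ((one_lt_div hr).2 (hrρ.trans_le hμρ))
  exact absurd (hle n) (not_le.2 hn)

/-! ### Compactness of the powers and the limiting idempotent -/

/-- The endomorphisms of a finite-dimensional space form a proper space, so this is a continuous
image of a compact ball. -/
theorem isCompact_comp_comp {X : Type*} [NormedAddCommGroup X] [NormedSpace ℂ X]
    [FiniteDimensional ℂ X] (i : X →L[ℂ] B) (p : B →L[ℂ] X) (R : ℝ) :
    IsCompact ((fun A : X →L[ℂ] X => i ∘L (A ∘L p)) '' {A | ‖A‖ ≤ R}) := by
  have : ProperSpace (X →L[ℂ] X) := FiniteDimensional.proper ℂ _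
  have hball : IsCompact {A : X →L[ℂ] X | ‖A‖ ≤ R} := by
    simpa [Metric.closedBall] using isCompact_closedBall (0 : X →L[ℂ] X) R
  exact hball.image (continuous_const.clm_comp (continuous_id.clm_comp continuous_const))

/-- The powers of a power-bounded operator that decays off a finite-dimensional invariant subspace
lie in a compact set. -/
theorem exists_isCompact_pow_mem {Q p : B →L[ℂ] B} {F : Submodule ℂ B} [FiniteDimensional ℂ F]
    (hpF : ∀ x, p x ∈ F) (hp : ∀ x ∈ F, p x = x) (hF : ∀ x ∈ F, Q x ∈ F) {C r M : ℝ} (hr : 0 < r)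
    (hr1 : r < 1) (hC : ∀ n, ‖Q ^ n * (1 - p)‖ ≤ C * r ^ n) (hM : ∀ n, ‖Q ^ n‖ ≤ M) :
    ∃ K : Set (B →L[ℂ] B), IsCompact K ∧ ∀ n, Q ^ n ∈ K := by
  let p₀ : B →L[ℂ] F := p.codRestrict F hpF
  have hlim : Tendsto (fun n => Q ^ n * (1 - p)) atTop (𝓝 0) := by
    refine squeeze_zero_norm hC ?_
    simpa using (tendsto_pow_atTop_nhds_zero_of_lt_one hr.le hr1).const_mul C
  have hFn : ∀ n, ∀ x ∈ F, (Q ^ n) x ∈ F := by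
    intro n
    induction n with
    | zero => exact fun x hx => hx
    | succ n ih => exact fun x hx => by rw [pow_succ]; exact ih _ (hF x hx)
  -- Split Qⁿ = pQⁿp + Qⁿ(1 - p): the first term factors boundedly through `F`, the second runs
  -- through a sequence tending to 0.
  refine ⟨_, (isCompact_comp_comp F.subtypeL p₀ (‖p₀‖ * (M * ‖F.subtypeL‖))).add
    hlim.isCompact_insert_range, fun n => ?_⟩
  refine ⟨_, ⟨p₀ ∘L ((Q ^ n) ∘L F.subtypeL), ?_, rfl⟩, _, Set.mem_insert_of_mem _ ⟨n, rfl⟩, ?_⟩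
  · refine (ContinuousLinearMap.opNorm_comp_le _ _).trans ?_
    gcongr
    refine (ContinuousLinearMap.opNorm_comp_le _ _).trans ?_
    gcongr
    exact hM n
  · ext x
    change p ((Q ^ n) (p x)) + (Q ^ n) (x - p x) = (Q ^ n) x
    rw [hp _ (hFn n _ (hpF x)), map_sub]
    abel

/-- Some subsequence of the powers converges to an idempotent with range in `F`. -/
theorem exists_tendsto_pow_idempotent {Q p : B →L[ℂ] B} {F : Submodule ℂ B}
    [FiniteDimensional ℂ F]
    (hpF : ∀ x, p x ∈ F) (hp : ∀ x ∈ F, p x = x) (hF : ∀ x ∈ F, Q x ∈ F) {C r M : ℝ} (hr : 0 < r)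
    (hr1 : r < 1) (hC : ∀ n, ‖Q ^ n * (1 - p)‖ ≤ C * r ^ n) (hM : ∀ n, ‖Q ^ n‖ ≤ M) :
    ∃ (L : B →L[ℂ] B) (φ : ℕ → ℕ), StrictMono φ ∧ Tendsto (fun j => Q ^ φ j) atTop (𝓝 L) ∧
      L * L = L ∧ ∀ x, L x ∈ F := by
  obtain ⟨K, hK, hQK⟩ := exists_isCompact_pow_mem hpF hp hF hr hr1 hC hM
  let s : Set (B →L[ℂ] B) := {A | MapClusterPt A atTop fun n => Q ^ n}
  have hs : ∀ A ∈ s, ∃ φ : ℕ → ℕ, StrictMono φ ∧ Tendsto (fun j => Q ^ φ j) atTop (𝓝 A) :=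
    fun A hA => MapClusterPt.tendsto_subseq hA
  have hsK : s ⊆ K := by
    intro A hA
    obtain ⟨φ, -, hφ⟩ := hs A hA
    exact hK.isClosed.mem_of_tendsto hφ (Eventually.of_forall fun j => hQK _)
  -- The Ellis–Numakura lemma, applied to the compact semigroup of cluster points of the powers.
  obtain ⟨L, hL, hLL⟩ := exists_idempotent_in_compact_subsemigroup
    (fun A : B →L[ℂ] B => continuous_id.mul continuous_const) s
    (by
      obtain ⟨A, -, hA⟩ := hK.exists_mapClusterPt (f := atTop) (u := fun n => Q ^ n)
        (by rw [le_principal_iff]; exact mem_map.2 (Eventually.of_forall hQK))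
      exact ⟨A, hA⟩)
    (hK.of_isClosed_subset isClosed_setOfPred_clusterPt hsK)
    (by
      intro A hA A' hA'
      obtain ⟨φ, hφm, hφ⟩ := hs A hA
      obtain ⟨ψ, hψm, hψ⟩ := hs A' hA'
      have h1 : Tendsto (fun j => Q ^ (φ j + ψ j)) atTop (𝓝 (A * A')) := by
        simpa only [pow_add] using hφ.mul hψ
      exact MapClusterPt.of_comp (hφm.add hψm).tendsto_atTop h1.mapClusterPt)
  obtain ⟨φ, hφm, hφ⟩ := hs L hL
  refine ⟨L, φ, hφm, hφ, hLL, fun x => ?_⟩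
  -- The decay off `F` passes to the limit, so `L` factors through `p`, and the closed subspace `F`
  -- absorbs its values.
  have hLp : L * (1 - p) = 0 := by
    refine tendsto_nhds_unique (hφ.mul_const (1 - p)) ?_
    refine squeeze_zero_norm (fun j => hC (φ j)) ?_
    simpa using ((tendsto_pow_atTop_nhds_zero_of_lt_one hr.le hr1).comp
      hφm.tendsto_atTop).const_mul C
  have hx : L x = L (p x) := by
    have := DFunLike.congr_fun hLp x
    have h2 : L (x - p x) = 0 := this
    rwa [map_sub, sub_eq_zero] at h2
  rw [hx]
  have hFn : ∀ n, ∀ x ∈ F, (Q ^ n) x ∈ F := by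
    intro n
    induction n with
    | zero => exact fun x hx => hx
    | succ n ih => exact fun x hx => by rw [pow_succ]; exact ih _ (hF x hx)
  have hFc : IsClosed (F : Set B) := F.closed_of_finiteDimensional
  exact hFc.mem_of_tendsto
    ((ContinuousLinearMap.apply ℂ B (p x)).continuous.tendsto L |>.comp hφ)
    (Eventually.of_forall fun j => hFn _ _ (hpF x))

/-- If powers of `Q` accumulate at an idempotent `L`, then `Qⁿ - QⁿL` decays geometrically. -/
theorem exists_norm_pow_sub_le [CompleteSpace B] {Q L : B →L[ℂ] B} {φ : ℕ → ℕ} (hφm : StrictMono φ)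
    (hφ : Tendsto (fun j => Q ^ φ j) atTop (𝓝 L)) (hLL : L * L = L) (hQL : Q * L = L * Q) :
    ∃ C ρ : ℝ, 0 ≤ ρ ∧ ρ < 1 ∧ ∀ n, ‖Q ^ n - Q ^ n * L‖ ≤ C * ρ ^ n := by
  have hidem : (1 - L) * (1 - L) = 1 - L := by
    rw [mul_sub, sub_mul, sub_mul, hLL]; simp
  have hcomm : Commute Q (1 - L) := by
    change Q * (1 - L) = (1 - L) * Q
    rw [mul_sub, sub_mul, hQL]; simp
  have hpow : ∀ n, (Q * (1 - L)) ^ (n + 1) = Q ^ (n + 1) * (1 - L) := fun n => by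
    rw [hcomm.mul_pow, (show IsIdempotentElem (1 - L) from hidem).pow_succ_eq n]
  have hlim : Tendsto (fun j => Q ^ φ j * (1 - L)) atTop (𝓝 0) := by
    have := hφ.mul_const (1 - L)
    rwa [mul_sub, hLL, mul_one, sub_self] at this
  obtain ⟨j, hj1, hj⟩ := ((hlim.norm.eventually_lt_const
    (by rw [norm_zero]; exact one_pos)).and (hφm.tendsto_atTop.eventually_ge_atTop 1)).exists
  obtain ⟨m, hm⟩ : ∃ m, φ j = m + 1 := ⟨φ j - 1, by omega⟩
  rw [hm, ← hpow] at hj1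
  -- One power of norm less than 1 suffices. The factor ‖1‖ in the general bound is at most 1, even
  -- when `B` is trivial.
  have hrad : spectralRadius ℂ (Q * (1 - L)) < ((1 : ℝ≥0) : ℝ≥0∞) := by
    refine (spectrum.spectralRadius_le_pow_nnnorm_pow_one_div ℂ (Q * (1 - L)) m).trans_lt ?_
    have hpos : (0 : ℝ) < 1 / (m + 1) := by positivity
    have h1 : (‖(1 : B →L[ℂ] B)‖₊ : ℝ≥0∞) ^ (1 / (m + 1) : ℝ) ≤ 1 := by
      refine ENNReal.rpow_le_one ?_ hpos.le
      exact_mod_cast ContinuousLinearMap.norm_id_le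
    have h2 : (‖(Q * (1 - L)) ^ (m + 1)‖₊ : ℝ≥0∞) ^ (1 / (m + 1) : ℝ) < 1 := by
      refine ENNReal.rpow_lt_one ?_ hpos
      exact_mod_cast hj1
    exact (mul_le_of_le_one_right (zero_le) h1).trans_lt (by simpa using h2)
  obtain ⟨r, hr0, hr1, C, hC⟩ := exists_opNorm_pow_le_of_spectralRadius_lt _ hrad
  -- The term ‖1 - L‖ covers n = 0, where the power of `Q * (1 - L)` is 1 and not 1 - L.
  refine ⟨max C ‖1 - L‖, r, hr0.le, by simpa using hr1, fun n => ?_⟩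
  rcases n with _ | n
  · simp
  · have h1 : Q ^ (n + 1) - Q ^ (n + 1) * L = (Q * (1 - L)) ^ (n + 1) := by
      rw [hpow, mul_sub, mul_one]
    rw [h1]
    exact (hC (n + 1)).trans (mul_le_mul_of_nonneg_right (le_max_left _ _) (by positivity))

/-! ### Finite order of a power-bounded operator on a finite-dimensional subspace -/

theorem pow_apply_of_eigenvector {Q : B →L[ℂ] B} {v : B} {μ : ℂ} (h : Q v = μ • v) (n : ℕ) :
    (Q ^ n) v = μ ^ n • v := by
  induction n with
  | zero => simp
  | succ n ih => rw [pow_succ, mul_apply_eq_comp, h, map_smul, ih, smul_smul, pow_succ']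

/-- A power-bounded operator whose eigenvalues on a finite-dimensional invariant subspace are
`d`-th roots of unity satisfies `Q ^ d = 1` there. -/
theorem pow_apply_eq_self {Q : B →L[ℂ] B} {V : Submodule ℂ B} [FiniteDimensional ℂ V]
    (hV : ∀ x ∈ V, Q x ∈ V) {M : ℝ} (hM : ∀ n, ‖Q ^ n‖ ≤ M) {d : ℕ} (hd0 : d ≠ 0)
    (hd : ∀ (μ : ℂ), ∀ v ∈ V, v ≠ 0 → Q v = μ • v → μ ^ d = 1) :
    ∀ v ∈ V, (Q ^ d) v = v := by
  have hNV : ∀ (μ : ℂ) (k : ℕ), ∀ v ∈ V, ((Q - μ • 1) ^ k) v ∈ V := by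
    intro μ k
    induction k with
    | zero => exact fun v hv => hv
    | succ k ih =>
      intro v hv
      rw [pow_succ]
      exact ih _ (V.sub_mem (hV v hv) (V.smul_mem μ hv))
  -- Generalized eigenvectors are genuine ones: for a Jordan chain Qu = μu + y, Qy = μy with |μ| =
  -- 1, the term (n + 1)μⁿy in Qⁿ⁺¹u grows linearly unless y = 0.
  have key : ∀ (μ : ℂ) (k : ℕ), ∀ v ∈ V, ((Q - μ • 1) ^ k) v = 0 → (Q ^ d) v = v := by
    intro μ k
    induction k with
    | zero =>
      intro v _ h
      have hv : v = 0 := h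
      rw [hv, map_zero]
    | succ k ih =>
      intro v hv h
      rcases k with _ | k
      · by_cases hv0 : v = 0
        · rw [hv0, map_zero]
        · have hQv : Q v = μ • v := by
            rw [zero_add, pow_one] at h
            exact sub_eq_zero.1 h
          rw [pow_apply_of_eigenvector hQv, hd μ v hv hv0 hQv, one_smul]
      · refine ih v hv ?_
        set u := ((Q - μ • 1) ^ k) v with hu
        have hy : ((Q - μ • 1) ^ (k + 1)) v = Q u - μ • u := by rw [pow_succ', hu]; rfl
        set y := Q u - μ • u with hydef
        have hyV : y ∈ V := V.sub_mem (hV u (hNV μ k v hv)) (V.smul_mem μ (hNV μ k v hv))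
        have hQy : Q y = μ • y := by
          rw [pow_succ', mul_apply_eq_comp, hy] at h
          exact sub_eq_zero.1 h
        rw [hy]
        by_contra hy0
        have hμ : ‖μ‖ = 1 := by
          have h1 := congrArg norm (hd μ y hyV hy0 hQy)
          rw [norm_pow, norm_one] at h1
          exact (pow_eq_one_iff_of_nonneg (norm_nonneg _) hd0).1 h1
        have hpow : ∀ n : ℕ, (Q ^ (n + 1)) u = μ ^ (n + 1) • u + ((n + 1 : ℂ) * μ ^ n) • y := by
          intro n
          induction n with
          | zero => simp [hydef]
          | succ n ihn =>
            rw [pow_succ', mul_apply_eq_comp, ihn, map_add, map_smul, map_smul, hQy,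
              show Q u = μ • u + y by rw [hydef]; abel]
            push_cast
            module
        have hbound : ∀ n : ℕ, (n + 1 : ℝ) * ‖y‖ ≤ M * ‖u‖ + ‖u‖ := by
          intro n
          have h1 : ((n + 1 : ℂ) * μ ^ n) • y = (Q ^ (n + 1)) u - μ ^ (n + 1) • u := by
            rw [hpow]; abel
          have h2 : ‖((n + 1 : ℂ) * μ ^ n) • y‖ = (n + 1 : ℝ) * ‖y‖ := by
            rw [norm_smul, norm_mul, norm_pow, hμ, one_pow, mul_one]
            congr 1
            exact_mod_cast Complex.norm_natCast (n + 1)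
          rw [← h2, h1]
          refine (norm_sub_le _ _).trans (add_le_add ?_ ?_)
          · exact ((Q ^ (n + 1)).le_opNorm u).trans
              (mul_le_mul_of_nonneg_right (hM _) (norm_nonneg _))
          · rw [norm_smul, norm_pow, hμ, one_pow, one_mul]
        have hy0' : 0 < ‖y‖ := norm_pos_iff.2 hy0
        obtain ⟨n, hn⟩ := exists_nat_gt ((M * ‖u‖ + ‖u‖) / ‖y‖)
        rw [div_lt_iff₀ hy0'] at hn
        nlinarith [hbound n]
  let U : Module.End ℂ V := (Q : B →ₗ[ℂ] B).restrict hV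
  have hUN : ∀ (μ : ℂ) (k : ℕ) (v : V),
      (((U - μ • 1) ^ k) v : B) = ((Q - μ • 1) ^ k) (v : B) := by
    intro μ k
    induction k with
    | zero => intro v; rfl
    | succ k ih =>
      intro v
      rw [pow_succ, pow_succ]
      exact ih ((U - μ • 1) v)
  let W : Submodule ℂ V := LinearMap.ker (((Q ^ d - 1 : B →L[ℂ] B) : B →ₗ[ℂ] B) ∘ₗ V.subtype)
  have hW : ⊤ ≤ W := by
    rw [← Module.End.iSup_maxGenEigenspace_eq_top U]
    refine iSup_le fun μ v hv => ?_
    obtain ⟨k, hk⟩ := (Module.End.mem_maxGenEigenspace U μ v).1 hv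
    have h1 : ((Q - μ • 1) ^ k) (v : B) = 0 := by rw [← hUN, hk]; rfl
    exact sub_eq_zero.2 (key μ k v v.2 h1)
  intro v hv
  exact sub_eq_zero.1 (hW (Submodule.mem_top (x := (⟨v, hv⟩ : V))))

theorem finite_eigenvalues_on (Q : B →L[ℂ] B) {V : Submodule ℂ B} [FiniteDimensional ℂ V]
    (hV : ∀ x ∈ V, Q x ∈ V) : {μ : ℂ | ∃ v ∈ V, v ≠ 0 ∧ Q v = μ • v}.Finite := by
  refine (Module.End.finite_hasEigenvalue ((Q : B →ₗ[ℂ] B).restrict hV)).subset ?_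
  rintro μ ⟨v, hv, hv0, h⟩
  exact Module.End.hasEigenvalue_of_hasEigenvector (x := ⟨v, hv⟩)
    ⟨Module.End.mem_eigenspace_iff.2 (Subtype.ext h), fun h => hv0 (congrArg Subtype.val h)⟩

/-- A power-bounded operator whose eigenvalues on a finite-dimensional invariant subspace are roots
of unity has finite order there. -/
theorem exists_pow_apply_eq_self {Q : B →L[ℂ] B} {V : Submodule ℂ B} [FiniteDimensional ℂ V]
    (hV : ∀ x ∈ V, Q x ∈ V) {M : ℝ} (hM : ∀ n, ‖Q ^ n‖ ≤ M)
    (h : ∀ (μ : ℂ), ∀ v ∈ V, v ≠ 0 → Q v = μ • v → ∃ k : ℕ, k ≠ 0 ∧ μ ^ k = 1) :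
    ∃ d : ℕ, 1 ≤ d ∧ ∀ v ∈ V, (Q ^ d) v = v := by
  have hfin := finite_eigenvalues_on Q hV
  have h' : ∀ μ : ℂ, ∃ k : ℕ, k ≠ 0 ∧ ((∃ v ∈ V, v ≠ 0 ∧ Q v = μ • v) → μ ^ k = 1) := by
    intro μ
    by_cases hμ : ∃ v ∈ V, v ≠ 0 ∧ Q v = μ • v
    · obtain ⟨v, hv, hv0, hQ⟩ := hμ
      obtain ⟨k, hk, hk1⟩ := h μ v hv hv0 hQ
      exact ⟨k, hk, fun _ => hk1⟩
    · exact ⟨1, one_ne_zero, fun hh => absurd hh hμ⟩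
  choose k hk0 hk using h'
  -- The product of the exponents is a common exponent for the finitely many eigenvalues.
  have hd0 : ∏ μ ∈ hfin.toFinset, k μ ≠ 0 := Finset.prod_ne_zero_iff.2 fun μ _ => hk0 μ
  refine ⟨∏ μ ∈ hfin.toFinset, k μ, Nat.one_le_iff_ne_zero.2 hd0,
    pow_apply_eq_self hV hM hd0 fun μ v hv hv0 hQ => ?_⟩
  have hmem : μ ∈ hfin.toFinset := hfin.mem_toFinset.2 ⟨v, hv, hv0, hQ⟩
  obtain ⟨c, hc⟩ := Finset.dvd_prod_of_mem k hmem
  rw [hc, pow_mul, hk μ ⟨v, hv, hv0, hQ⟩, one_pow]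

end Operators

/-- Bounded sequences in a finite-dimensional subspace have convergent subsequences. -/
theorem exists_tendsto_subseq_of_mem {B : Type*} [NormedAddCommGroup B] [NormedSpace ℂ B]
    (V : Submodule ℂ B) [FiniteDimensional ℂ V] {v : ℕ → B} (hv : ∀ k, v k ∈ V) {M : ℝ}
    (hM : ∀ k, ‖v k‖ ≤ M) :
    ∃ u ∈ V, ∃ φ : ℕ → ℕ, StrictMono φ ∧ Tendsto (fun j => v (φ j)) atTop (𝓝 u) := by
  have : ProperSpace V := FiniteDimensional.proper ℂ V
  obtain ⟨u, -, φ, hφ, hu⟩ := tendsto_subseq_of_bounded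
    (Metric.isBounded_closedBall (x := (0 : V)) (r := M)) (x := fun k => (⟨v k, hv k⟩ : V))
    (fun k => by simpa using hM k)
  exact ⟨u, u.2, φ, hφ, (continuous_subtype_val.tendsto u).comp hu⟩

/-! ### Completeness of the weighted space and simple approximations -/

variable {E : Type*} [MeasurableSpace E] {w : Weight E}

namespace WBounded

theorem sub_apply (f g : WBounded w) (x : E) : (f - g) x = f x - g x := rfl

theorem zero_apply (x : E) : (0 : WBounded w) x = 0 := rfl

theorem tendsto_apply {ι : Type*} {l : Filter ι} {f : ι → WBounded w} {g : WBounded w}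
    (h : Tendsto f l (𝓝 g)) (x : E) : Tendsto (fun i => f i x) l (𝓝 (g x)) := by
  rw [tendsto_iff_norm_sub_tendsto_zero] at h ⊢
  refine squeeze_zero (fun _ => norm_nonneg _) (fun i => norm_apply_le (f i - g) x) ?_
  simpa using h.mul_const (w x)

instance : CompleteSpace (WBounded w) := by
  refine Metric.complete_of_cauchySeq_tendsto fun u hu => ?_
  have hpt : ∀ x, ∃ a, Tendsto (fun n => u n x) atTop (𝓝 a) := fun x => by
    refine cauchySeq_tendsto_of_complete (Metric.cauchySeq_iff.2 fun ε hε => ?_)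
    obtain ⟨N, hN⟩ := Metric.cauchySeq_iff.1 hu (ε / w x) (div_pos hε (w.pos x))
    refine ⟨N, fun m hm n hn => ?_⟩
    rw [dist_eq_norm, ← sub_apply]
    refine (norm_apply_le _ x).trans_lt ?_
    rw [← lt_div_iff₀ (w.pos x), ← dist_eq_norm]
    exact hN m hm n hn
  choose g hg using hpt
  have hgm : Measurable g := measurable_of_tendsto_metrizable (fun n => (u n).measurable)
    (tendsto_pi_nhds.2 hg)
  -- Letting m tend to infinity in the Cauchy estimate makes the pointwise convergence uniform
  -- relative to `w`.
  have hclose : ∀ ε > 0, ∃ N, ∀ n ≥ N, ∀ x, ‖u n x - g x‖ ≤ ε * w x := by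
    intro ε hε
    obtain ⟨N, hN⟩ := Metric.cauchySeq_iff.1 hu ε hε
    refine ⟨N, fun n hn x => ?_⟩
    refine le_of_tendsto ((tendsto_const_nhds.sub (hg x)).norm) ?_
    filter_upwards [eventually_ge_atTop N] with m hm
    rw [← sub_apply]
    refine (norm_apply_le _ x).trans (mul_le_mul_of_nonneg_right ?_ (w.pos x).le)
    rw [← dist_eq_norm]
    exact (hN n hn m hm).le
  obtain ⟨N, hN⟩ := hclose 1 one_pos
  have hgb : BddAbove (Set.range fun x => ‖g x‖ / w x) := by
    refine ⟨‖u N‖ + 1, ?_⟩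
    rintro _ ⟨x, rfl⟩
    refine (div_le_iff₀ (w.pos x)).2 ?_
    have h1 := hN N le_rfl x
    have h2 := norm_apply_le (u N) x
    have h3 : ‖g x‖ ≤ ‖u N x‖ + ‖u N x - g x‖ := norm_le_norm_add_norm_sub _ _
    linarith
  obtain ⟨G, hG⟩ : ∃ G : WBounded w, ∀ x, G x = g x := ⟨⟨g, hgm, hgb⟩, fun _ => rfl⟩
  refine ⟨G, Metric.tendsto_atTop.2 fun ε hε => ?_⟩
  obtain ⟨N, hN⟩ := hclose (ε / 2) (half_pos hε)
  refine ⟨N, fun n hn => ?_⟩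
  rw [dist_eq_norm]
  exact (norm_le_of_forall (half_pos hε).le fun x => by
    rw [sub_apply, hG]; exact hN n hn x).trans_lt (half_lt_self hε)

/-- A bounded measurable function as an element of `𝓑_w`. -/
def ofBounded (w : Weight E) (g : E → ℂ) (hg : Measurable g) (hb : ∃ M, ∀ x, ‖g x‖ ≤ M) :
    WBounded w :=
  ⟨g, hg, by
    obtain ⟨M, hM⟩ := hb
    refine ⟨M, ?_⟩
    rintro _ ⟨x, rfl⟩
    exact (div_le_self (norm_nonneg _) (w.one_le' x)).trans (hM x)⟩

theorem norm_le_of_bounded {f : WBounded w} {M : ℝ} (hM : 0 ≤ M) (h : ∀ x, ‖f x‖ ≤ M) :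
    ‖f‖ ≤ M :=
  norm_le_of_forall hM fun x => (h x).trans (le_mul_of_one_le_right hM (w.one_le' x))

/-- The bounded functions in `𝓑_w`. -/
def boundedFunctions (w : Weight E) : Submodule ℂ (WBounded w) where
  carrier := {f | ∃ M : ℝ, ∀ x, ‖f x‖ ≤ M}
  zero_mem' := ⟨0, fun x => by rw [zero_apply, norm_zero]⟩
  add_mem' := by
    rintro f g ⟨a, ha⟩ ⟨b, hb⟩
    exact ⟨a + b, fun x => by
      rw [add_apply]; exact (norm_add_le _ _).trans (add_le_add (ha x) (hb x))⟩
  smul_mem' := by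
    rintro c f ⟨a, ha⟩
    exact ⟨‖c‖ * a, fun x => by
      rw [smul_apply, norm_mul]; exact mul_le_mul_of_nonneg_left (ha x) (norm_nonneg c)⟩

/-- A simple function as an element of `𝓑_w`. -/
noncomputable def ofSimple (w : Weight E) (s : SimpleFunc E ℂ) : WBounded w :=
  ofBounded w s s.measurable (by
    obtain ⟨M, hM⟩ := s.exists_forall_norm_le
    exact ⟨M, hM⟩)

theorem ofSimple_apply (s : SimpleFunc E ℂ) (x : E) : ofSimple w s x = s x := rfl

theorem ofSimple_mem (s : SimpleFunc E ℂ) : ofSimple w s ∈ boundedFunctions w :=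
  s.exists_forall_norm_le

/-- The standard approximation of a function in `𝓑_w` by simple functions. -/
noncomputable def approx (f : WBounded w) (k : ℕ) : SimpleFunc E ℂ :=
  SimpleFunc.approxOn f f.measurable Set.univ 0 (Set.mem_univ 0) k

theorem norm_approx_le (f : WBounded w) (k : ℕ) (x : E) : ‖f.approx k x‖ ≤ 2 * ‖f x‖ := by
  rw [two_mul]
  exact SimpleFunc.norm_approxOn_zero_le f.measurable (Set.mem_univ 0) x k

theorem tendsto_approx (f : WBounded w) (x : E) :
    Tendsto (fun k => f.approx k x) atTop (𝓝 (f x)) :=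
  SimpleFunc.tendsto_approxOn f.measurable (Set.mem_univ 0) (by simp)

theorem norm_ofSimple_approx_le (f : WBounded w) (k : ℕ) :
    ‖ofSimple w (f.approx k)‖ ≤ 2 * ‖f‖ := by
  refine norm_le_of_forall (by positivity) fun x => ?_
  rw [ofSimple_apply, mul_assoc]
  exact (f.norm_approx_le k x).trans (mul_le_mul_of_nonneg_left (norm_apply_le f x) two_pos.le)

end WBounded

/-! ### Sigma-continuity and power-boundedness -/

open WBounded

/-- Continuity along pointwise convergent, norm-bounded sequences. -/
def SigmaContinuous (A : WBounded w →L[ℂ] WBounded w) : Prop :=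
  ∀ (f : ℕ → WBounded w) (g : WBounded w) (M : ℝ), (∀ k, ‖f k‖ ≤ M) →
    (∀ x, Tendsto (fun k => f k x) atTop (𝓝 (g x))) →
    ∀ x, Tendsto (fun k => A (f k) x) atTop (𝓝 (A g x))

/-- Dominated convergence, with majorant M·w, integrable because `Q` acts on the weighted space. -/
theorem sigmaContinuous_kernelOp {Q : Kernel E E} (h : ActsOn Q w) :
    SigmaContinuous (kernelOp Q w h) := by
  intro f g M hM hfg x
  refine tendsto_integral_of_dominated_convergence (fun y => M * w y)
    (fun k => (f k).measurable.aestronglyMeasurable) ((h.integrable_weight x).const_mul M)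
    (fun k => Eventually.of_forall fun y => ?_) (Eventually.of_forall hfg)
  exact (norm_apply_le (f k) y).trans (mul_le_mul_of_nonneg_right (hM k) (w.pos y).le)

theorem SigmaContinuous.pow {A : WBounded w →L[ℂ] WBounded w} (hA : SigmaContinuous A) (n : ℕ) :
    SigmaContinuous (A ^ n) := by
  induction n with
  | zero => exact fun f g M _ hfg x => hfg x
  | succ n ih =>
    intro f g M hM hfg x
    rw [pow_succ]
    refine ih (fun k => A (f k)) (A g) (‖A‖ * M) (fun k => ?_) (hA f g M hM hfg) x
    exact (A.le_opNorm _).trans (mul_le_mul_of_nonneg_left (hM k) (norm_nonneg _))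

/-- A three-ε argument at a fixed point: at `x`, replacing `L` by `A j` costs at most ‖A j - L‖·w(x)
times a norm bound common to all the functions involved. -/
theorem SigmaContinuous.of_tendsto {A : ℕ → WBounded w →L[ℂ] WBounded w}
    {L : WBounded w →L[ℂ] WBounded w} (hA : ∀ j, SigmaContinuous (A j))
    (hL : Tendsto A atTop (𝓝 L)) : SigmaContinuous L := by
  intro f g M hM hfg x
  have hM0 : 0 ≤ M := (norm_nonneg _).trans (hM 0)
  rw [Metric.tendsto_atTop]
  intro ε hε
  have hden : 0 < 3 * ((M + ‖g‖ + 1) * w x) := by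
    have := w.pos x
    positivity
  obtain ⟨j, hj⟩ := ((tendsto_iff_norm_sub_tendsto_zero.1 hL).eventually_lt_const
    (div_pos hε hden)).exists
  obtain ⟨N, hN⟩ := Metric.tendsto_atTop.1 (hA j f g M hM hfg x) (ε / 3) (by positivity)
  have hest : ∀ h : WBounded w, ‖h‖ ≤ M + ‖g‖ + 1 → ‖A j h x - L h x‖ < ε / 3 := by
    intro h hh
    have h1 := norm_apply_le ((A j - L) h) x
    have h2 : ‖(A j - L) h‖ ≤ ‖A j - L‖ * (M + ‖g‖ + 1) :=
      ((A j - L).le_opNorm h).trans (mul_le_mul_of_nonneg_left hh (norm_nonneg _))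
    have h3 : ‖A j h x - L h x‖ ≤ ‖A j - L‖ * ((M + ‖g‖ + 1) * w x) := by
      rw [← mul_assoc]
      exact h1.trans (mul_le_mul_of_nonneg_right h2 (w.pos x).le)
    refine h3.trans_lt ?_
    rw [lt_div_iff₀ hden] at hj
    linarith
  refine ⟨N, fun k hk => ?_⟩
  have e1 := hest (f k) (by linarith [hM k, norm_nonneg g])
  have e2 := hest g (by linarith)
  have e3 := hN k hk
  rw [dist_eq_norm] at e3 ⊢
  have : L (f k) x - L g x = -(A j (f k) x - L (f k) x) + (A j (f k) x - A j g x) +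
      (A j g x - L g x) := by ring
  rw [this]
  refine (norm_add_le _ _).trans_lt ?_
  have := norm_add_le (-(A j (f k) x - L (f k) x)) (A j (f k) x - A j g x)
  rw [norm_neg] at this
  linarith

/-- The spectral projection onto the dominant part of a sigma-continuous operator takes all its
values on bounded functions. -/
theorem exists_bounded_projection_eq {T p : WBounded w →L[ℂ] WBounded w} (hT : SigmaContinuous T)
    {F : Submodule ℂ (WBounded w)} [FiniteDimensional ℂ F] {C r ρ : ℝ} (hr : 0 < r) (hrρ : r < ρ)
    (hpF : ∀ x, p x ∈ F) (hF : ∀ x ∈ F, T x ∈ F)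
    (hC : ∀ n, ‖T ^ n * (1 - p)‖ ≤ C * r ^ n)
    (hev : ∀ (μ : ℂ), ∀ v ∈ F, v ≠ 0 → T v = μ • v → ρ ≤ ‖μ‖) (f : WBounded w) :
    ∃ g ∈ boundedFunctions w, p f = p g := by
  -- Bounded functions need not be dense in norm, but `V` is finite-dimensional: the projections of
  -- simple approximations of `f` have a subsequential limit `u` in `V`, and the claim is `p f = u`.
  let V : Submodule ℂ (WBounded w) := (boundedFunctions w).map (p : WBounded w →ₗ[ℂ] WBounded w)
  have hVF : V ≤ F := by
    rintro _ ⟨g, -, rfl⟩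
    exact hpF g
  have : FiniteDimensional ℂ V := Submodule.finiteDimensional_of_le hVF
  let s : ℕ → WBounded w := fun k => ofSimple w (f.approx k)
  have hs : ∀ k, ‖s k‖ ≤ 2 * ‖f‖ := f.norm_ofSimple_approx_le
  obtain ⟨u, hu, φ, hφ, hlim⟩ := exists_tendsto_subseq_of_mem V (v := fun k => p (s k))
    (fun k => ⟨s k, ofSimple_mem _, rfl⟩) (M := ‖p‖ * (2 * ‖f‖))
    (fun k => (p.le_opNorm _).trans (mul_le_mul_of_nonneg_left (hs k) (norm_nonneg _)))
  have hfs : ∀ k, ‖f - s k‖ ≤ 3 * ‖f‖ := fun k => by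
    have := norm_sub_le f (s k)
    linarith [hs k]
  -- Tⁿp(f - sⱼ) differs by Tⁿ(1 - p)(f - sⱼ), of norm O(rⁿ), from Tⁿ(f - sⱼ), which tends to 0
  -- pointwise by sigma-continuity. No non-zero vector of `F` decays this fast.
  have hdecay : ∀ n, ‖(T ^ n) (p f - u)‖ ≤ (C * (3 * ‖f‖)) * r ^ n := by
    intro n
    have hCr : 0 ≤ C * r ^ n := (norm_nonneg _).trans (hC n)
    refine norm_le_of_forall (by nlinarith [norm_nonneg f]) fun x => ?_
    have h1 : Tendsto (fun j => (T ^ n) (p (f - s (φ j))) x) atTop (𝓝 ((T ^ n) (p f - u) x)) := by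
      refine tendsto_apply ?_ x
      refine ((T ^ n).continuous.tendsto _).comp ?_
      simpa only [map_sub] using tendsto_const_nhds.sub hlim
    have h2 : Tendsto (fun j => (T ^ n) (f - s (φ j)) x) atTop (𝓝 0) := by
      have := hT.pow n (fun j => f - s (φ j)) 0 (3 * ‖f‖) (fun j => hfs _) (fun y => by
        have h3 := (f.tendsto_approx y).comp hφ.tendsto_atTop
        have h4 := (tendsto_const_nhds (x := f y)).sub h3
        rw [sub_self] at h4
        exact h4) x
      rwa [map_zero, WBounded.zero_apply] at this
    have h3 := (h1.sub h2).norm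
    rw [sub_zero] at h3
    refine le_of_tendsto h3 (Eventually.of_forall fun j => ?_)
    have h4 : (T ^ n) (p (f - s (φ j))) x - (T ^ n) (f - s (φ j)) x =
        -((T ^ n * (1 - p)) (f - s (φ j)) x) := by
      have : (T ^ n * (1 - p)) (f - s (φ j)) =
          (T ^ n) (f - s (φ j)) - (T ^ n) (p (f - s (φ j))) := by
        rw [← map_sub]; rfl
      rw [this, WBounded.sub_apply, neg_sub]
    rw [h4, norm_neg]
    refine (norm_apply_le _ x).trans (mul_le_mul_of_nonneg_right ?_ (w.pos x).le)
    refine ((T ^ n * (1 - p)).le_opNorm _).trans ?_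
    calc ‖T ^ n * (1 - p)‖ * ‖f - s (φ j)‖ ≤ (C * r ^ n) * (3 * ‖f‖) :=
          mul_le_mul (hC n) (hfs _) (norm_nonneg _) hCr
      _ = _ := by ring
  obtain ⟨g, hg, hgu⟩ := hu
  refine ⟨g, hg, ?_⟩
  have hz := eq_zero_of_norm_pow_le hr hrρ hF hev (F.sub_mem (hpF f) (hVF ⟨g, hg, hgu⟩)) hdecay
  rw [sub_eq_zero] at hz
  rw [hz, ← hgu]
  rfl

/-- Averaging against probability measures does not increase a supremum bound; this is the only a
priori control that is uniform in `n`. -/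
theorem norm_kernelOp_pow_apply_le {P : Kernel E E} [IsMarkovKernel P] (h : ActsOn P w)
    {f : WBounded w} {M : ℝ} (hf : ∀ x, ‖f x‖ ≤ M) (n : ℕ) (x : E) :
    ‖(kernelOp P w h ^ n) f x‖ ≤ M := by
  induction n generalizing x with
  | zero => exact hf x
  | succ n ih =>
    rw [pow_succ', mul_apply_eq_comp, kernelOp_apply]
    refine (norm_integral_le_of_norm_le_const (Eventually.of_forall ih)).trans ?_
    simp

/-- A quasi-compact Markov kernel is power-bounded, and its powers accumulate at a finite-rank
idempotent. -/
theorem exists_tendsto_kernelOp_pow_idempotent {P : Kernel E E} [IsMarkovKernel P]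
    (h : ActsOn P w) (hqc : IsQuasiCompact (kernelOp P w h)) :
    (∃ M : ℝ, ∀ n, ‖kernelOp P w h ^ n‖ ≤ M) ∧
    ∃ (L : WBounded w →L[ℂ] WBounded w) (φ : ℕ → ℕ), StrictMono φ ∧
      Tendsto (fun j => kernelOp P w h ^ φ j) atTop (𝓝 L) ∧ L * L = L ∧
      FiniteDimensional ℂ L.range := by
  set T := kernelOp P w h with hTdef
  obtain ⟨ρ, hρT, hsplit⟩ : ∃ ρ : ℝ≥0, (ρ : ℝ≥0∞) < spectralRadius ℂ T ∧
      HasSpectralSplitting T ρ := by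
    obtain ⟨a, ha, haT⟩ := sInf_lt_iff.1 hqc
    rcases ha with ha | ⟨ρ, rfl, hρ⟩
    · exact absurd haT (by rw [Set.mem_singleton_iff.1 ha]; exact lt_irrefl _)
    · exact ⟨ρ, haT, hρ⟩
  obtain ⟨F, p, C, r, hfin, hr, hrρ, hpF, hp, hcomm, hF, hC, hev⟩ := hsplit.exists_projection
  have hTs : SigmaContinuous T := sigmaContinuous_kernelOp h
  have hbd : ∀ f, ∃ M : ℝ, ∀ n, ‖(T ^ n) (p f)‖ ≤ M := by
    intro f
    obtain ⟨g, ⟨M, hM⟩, hg⟩ := exists_bounded_projection_eq hTs hr hrρ hpF hF hC hev f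
    refine ⟨‖p‖ * max M 0, fun n => ?_⟩
    have h1 : (T ^ n) (p g) = p ((T ^ n) g) :=
      DFunLike.congr_fun ((show Commute T p from hcomm).pow_left n).eq g
    rw [hg, h1]
    refine (p.le_opNorm _).trans (mul_le_mul_of_nonneg_left ?_ (norm_nonneg _))
    exact norm_le_of_bounded (le_max_right _ _) fun x =>
      (norm_kernelOp_pow_apply_le h hM n x).trans (le_max_left _ _)
  -- If ρ > 1, a bounded orbit counts as decay below the level ρ, so p = 0 and r(T) ≤ r < ρ < r(T).
  have hρ1 : (ρ : ℝ) ≤ 1 := by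
    by_contra! hρ1
    have hp0 : p = 0 := by
      ext1 f
      obtain ⟨M, hM⟩ := hbd f
      exact eq_zero_of_norm_pow_le one_pos hρ1 hF hev (hpF f) (C := M) (by simpa using hM)
    have h1 : spectralRadius ℂ T ≤ ENNReal.ofReal r :=
      spectralRadius_le_of_norm_pow_le T hr (by simpa [hp0] using hC)
    refine absurd (hρT.trans_le h1) (not_lt.2 ?_)
    exact ENNReal.ofReal_le_of_le_toReal (by simpa using hrρ.le)
  have hr1 : r < 1 := hrρ.trans_le hρ1
  obtain ⟨M, hM⟩ : ∃ M : ℝ, ∀ n, ‖T ^ n‖ ≤ M := by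
    refine banach_steinhaus fun f => ?_
    obtain ⟨M, hM⟩ := hbd f
    refine ⟨M + C * ‖f‖, fun n => ?_⟩
    have h1 : (T ^ n) f = (T ^ n) (p f) + (T ^ n * (1 - p)) f := by
      change _ = (T ^ n) (p f) + (T ^ n) (f - p f)
      rw [map_sub]; abel
    have hC0 : 0 ≤ C := by simpa using (norm_nonneg _).trans (hC 0)
    rw [h1]
    refine (norm_add_le _ _).trans (add_le_add (hM n) ?_)
    refine ((T ^ n * (1 - p)).le_opNorm f).trans (mul_le_mul_of_nonneg_right ?_ (norm_nonneg _))
    exact (hC n).trans (mul_le_of_le_one_right hC0 (pow_le_one₀ hr.le hr1.le))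
  refine ⟨⟨M, hM⟩, ?_⟩
  obtain ⟨L, φ, hφ, hL, hLL, hLF⟩ := exists_tendsto_pow_idempotent hpF hp hF hr hr1 hC hM
  refine ⟨L, φ, hφ, hL, hLL, Submodule.finiteDimensional_of_le (S₂ := F) ?_⟩
  rintro _ ⟨f, rfl⟩
  exact hLF f

/-! ### Positivity -/

/-- The operator preserves non-negativity of real parts. -/
def RePositive (A : WBounded w →L[ℂ] WBounded w) : Prop :=
  ∀ f : WBounded w, (∀ x, 0 ≤ (f x).re) → ∀ x, 0 ≤ (A f x).re

theorem re_kernelOp_apply {Q : Kernel E E} (h : ActsOn Q w) (f : WBounded w) (x : E) :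
    (kernelOp Q w h f x).re = ∫ y, (f y).re ∂(Q x) :=
  (Complex.reCLM.integral_comp_comm (h.integrable f x)).symm

theorem rePositive_kernelOp {Q : Kernel E E} (h : ActsOn Q w) : RePositive (kernelOp Q w h) := by
  intro f hf x
  rw [re_kernelOp_apply]
  exact integral_nonneg hf

theorem RePositive.pow {A : WBounded w →L[ℂ] WBounded w} (hA : RePositive A) (n : ℕ) :
    RePositive (A ^ n) := by
  induction n with
  | zero => exact fun f hf => hf
  | succ n ih =>
    intro f hf
    rw [pow_succ]
    exact ih (A f) (hA f hf)

theorem tendsto_apply_apply {A : ℕ → WBounded w →L[ℂ] WBounded w}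
    {L : WBounded w →L[ℂ] WBounded w} (hL : Tendsto A atTop (𝓝 L)) (f : WBounded w) (x : E) :
    Tendsto (fun j => A j f x) atTop (𝓝 (L f x)) :=
  tendsto_apply (((ContinuousLinearMap.apply ℂ (WBounded w) f).continuous.tendsto L).comp hL) x

theorem RePositive.of_tendsto {A : ℕ → WBounded w →L[ℂ] WBounded w}
    {L : WBounded w →L[ℂ] WBounded w} (hA : ∀ j, RePositive (A j))
    (hL : Tendsto A atTop (𝓝 L)) : RePositive L := fun f hf x =>
  ge_of_tendsto ((Complex.continuous_re.tendsto _).comp (tendsto_apply_apply hL f x))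
    (Eventually.of_forall fun j => hA j f hf x)

theorem RePositive.mono {A : WBounded w →L[ℂ] WBounded w} (hA : RePositive A) {f g : WBounded w}
    (h : ∀ x, (f x).re ≤ (g x).re) (x : E) : (A f x).re ≤ (A g x).re := by
  have h1 := hA (g - f) (fun y => by
    rw [WBounded.sub_apply, Complex.sub_re]; exact sub_nonneg.2 (h y)) x
  rwa [map_sub, WBounded.sub_apply, Complex.sub_re, sub_nonneg] at h1

/-- Both if and -if have zero real part, so positivity applies to each. -/
theorem RePositive.im_eq_zero {A : WBounded w →L[ℂ] WBounded w} (hA : RePositive A)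
    {f : WBounded w} (h : ∀ x, (f x).im = 0) (x : E) : (A f x).im = 0 := by
  have h1 := hA (Complex.I • f) (fun y => by rw [WBounded.smul_apply]; simp [h y]) x
  have h2 := hA ((-Complex.I) • f) (fun y => by rw [WBounded.smul_apply]; simp [h y]) x
  rw [map_smul, WBounded.smul_apply] at h1 h2
  simp at h1 h2
  linarith

namespace WBounded

/-- The indicator of a measurable set as an element of `𝓑_w`. -/
noncomputable def ind (w : Weight E) (A : Set E) (hA : MeasurableSet A) : WBounded w :=
  ofBounded w (A.indicator fun _ => 1) (measurable_const.indicator hA) ⟨1, fun x => by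
    by_cases hx : x ∈ A <;> simp [hx]⟩

theorem ind_of_mem {A : Set E} (hA : MeasurableSet A) {x : E} (hx : x ∈ A) :
    ind w A hA x = 1 := Set.indicator_of_mem (f := fun _ => (1 : ℂ)) hx

theorem ind_of_notMem {A : Set E} (hA : MeasurableSet A) {x : E} (hx : x ∉ A) :
    ind w A hA x = 0 := Set.indicator_of_notMem (f := fun _ => (1 : ℂ)) hx

theorem ind_re_nonneg {A : Set E} (hA : MeasurableSet A) (x : E) : 0 ≤ (ind w A hA x).re := by
  by_cases hx : x ∈ A
  · rw [ind_of_mem hA hx]; simp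
  · rw [ind_of_notMem hA hx]; simp

theorem ind_im {A : Set E} (hA : MeasurableSet A) (x : E) : (ind w A hA x).im = 0 := by
  by_cases hx : x ∈ A
  · rw [ind_of_mem hA hx]; simp
  · rw [ind_of_notMem hA hx]; simp

theorem sum_apply {ι : Type*} (s : Finset ι) (f : ι → WBounded w) (x : E) :
    (∑ i ∈ s, f i) x = ∑ i ∈ s, f i x := by
  classical
  induction s using Finset.induction_on with
  | empty => simp only [Finset.sum_empty]; rfl
  | insert a s ha ih => rw [Finset.sum_insert ha, Finset.sum_insert ha, WBounded.add_apply, ih]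

/-- The weight itself as an element of `𝓑_w`. -/
noncomputable def weight (w : Weight E) : WBounded w :=
  ⟨fun x => (w x : ℂ), Complex.measurable_ofReal.comp w.measurable', by
    refine ⟨1, ?_⟩
    rintro _ ⟨x, rfl⟩
    change ‖(w x : ℂ)‖ / w x ≤ 1
    rw [Complex.norm_real, Real.norm_of_nonneg (w.pos x).le, div_self (w.pos x).ne']⟩

theorem weight_apply (x : E) : weight w x = (w x : ℂ) := rfl

theorem norm_weight_le : ‖weight w‖ ≤ 1 := norm_le_of_forall zero_le_one fun x => by
  rw [weight_apply, Complex.norm_real, Real.norm_of_nonneg (w.pos x).le, one_mul]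

end WBounded

/-! ### Positive sigma-continuous operators as kernels -/

section Representation

variable {L : WBounded w →L[ℂ] WBounded w}

/-- Countable additivity: the partial sums of the indicators converge pointwise and have norm at
most 1. -/
theorem tsum_ofReal_re_ind (hs : SigmaContinuous L) (hp : RePositive L) {A : ℕ → Set E}
    (hA : ∀ i, MeasurableSet (A i)) (hd : Pairwise fun i j => Disjoint (A i) (A j)) (x : E) :
    ENNReal.ofReal (L (ind w (⋃ i, A i) (MeasurableSet.iUnion hA)) x).re =
      ∑' i, ENNReal.ofReal (L (ind w (A i) (hA i)) x).re := by
  let f : ℕ → WBounded w := fun k => ∑ i ∈ Finset.range k, ind w (A i) (hA i)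
  have hmem : ∀ k j y, y ∈ A j → f k y = if j < k then 1 else 0 := by
    intro k j y hy
    rw [show f k y = _ from WBounded.sum_apply _ _ y]
    have hne : ∀ i, i ≠ j → ind w (A i) (hA i) y = 0 := fun i hi =>
      ind_of_notMem (hA i) fun hyi => Set.disjoint_left.1 (hd hi) hyi hy
    split_ifs with hjk
    · rw [Finset.sum_eq_single_of_mem j (Finset.mem_range.2 hjk) fun i _ hi => hne i hi,
        ind_of_mem (hA j) hy]
    · refine Finset.sum_eq_zero fun i hi => hne i fun hij => hjk ?_
      exact hij ▸ Finset.mem_range.1 hi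
  have hnot : ∀ k y, y ∉ ⋃ i, A i → f k y = 0 := by
    intro k y hy
    rw [show f k y = _ from WBounded.sum_apply _ _ y]
    exact Finset.sum_eq_zero fun i _ =>
      ind_of_notMem (hA i) fun hyi => hy (Set.mem_iUnion.2 ⟨i, hyi⟩)
  have hbound : ∀ k, ‖f k‖ ≤ 1 := fun k => norm_le_of_bounded zero_le_one fun y => by
    by_cases hy : y ∈ ⋃ i, A i
    · obtain ⟨j, hj⟩ := Set.mem_iUnion.1 hy
      rw [hmem k j y hj]
      split_ifs <;> simp
    · rw [hnot k y hy]; simp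
  have hlim := hs f (ind w (⋃ i, A i) (MeasurableSet.iUnion hA)) 1 hbound (fun y => by
    by_cases hy : y ∈ ⋃ i, A i
    · obtain ⟨j, hj⟩ := Set.mem_iUnion.1 hy
      rw [ind_of_mem _ hy]
      refine tendsto_const_nhds.congr' ?_
      filter_upwards [eventually_gt_atTop j] with k hk
      rw [hmem k j y hj, if_pos hk]
    · rw [ind_of_notMem _ hy]
      exact tendsto_const_nhds.congr fun k => (hnot k y hy).symm) x
  have h1 := (ENNReal.continuous_ofReal.tendsto _).comp
    ((Complex.continuous_re.tendsto _).comp hlim)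
  refine tendsto_nhds_unique h1 ?_
  refine (ENNReal.tendsto_nat_tsum fun i => ENNReal.ofReal (L (ind w (A i) (hA i)) x).re).congr ?_
  intro k
  rw [← ENNReal.ofReal_sum_of_nonneg fun i _ => hp _ (ind_re_nonneg (hA i)) x]
  change _ = ENNReal.ofReal (L (f k) x).re
  rw [map_sum, WBounded.sum_apply, Complex.re_sum]

/-- A sigma-continuous positive operator is given on indicators by a kernel. -/
theorem exists_kernel_apply_eq (hs : SigmaContinuous L) (hp : RePositive L) :
    ∃ S : Kernel E E, ∀ (x : E) (A : Set E) (hA : MeasurableSet A),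
      S x A = ENNReal.ofReal (L (ind w A hA) x).re := by
  let m : E → Measure E := fun x => Measure.ofMeasurable
    (fun A hA => ENNReal.ofReal (L (ind w A hA) x).re)
    (by
      have : ind w ∅ MeasurableSet.empty = 0 := WBounded.ext fun y => by
        rw [ind_of_notMem _ (Set.notMem_empty y)]; rfl
      simp only [this, map_zero, WBounded.zero_apply, Complex.zero_re, ENNReal.ofReal_zero])
    (fun A hA hd => tsum_ofReal_re_ind hs hp hA hd x)
  have hm : ∀ (x : E) (A : Set E) (hA : MeasurableSet A),
      m x A = ENNReal.ofReal (L (ind w A hA) x).re :=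
    fun x A hA => Measure.ofMeasurable_apply A hA
  refine ⟨⟨m, Measure.measurable_of_measurable_coe _ fun A hA => ?_⟩, hm⟩
  simp only [hm _ A hA]
  exact (Complex.measurable_re.comp (L (ind w A hA)).measurable).ennreal_ofReal

/-- A sigma-continuous positive operator fixing the constants is a Markov kernel. -/
theorem exists_markov_kernelOp_eq (hs : SigmaContinuous L) (hp : RePositive L)
    (h1 : L (ind w Set.univ MeasurableSet.univ) = ind w Set.univ MeasurableSet.univ) :
    ∃ (S : Kernel E E) (hS : ActsOn S w), IsMarkovKernel S ∧ kernelOp S w hS = L := by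
  obtain ⟨S, hS⟩ := exists_kernel_apply_eq hs hp
  have hM : IsMarkovKernel S := ⟨fun x => ⟨by
    rw [hS x _ MeasurableSet.univ, h1, ind_of_mem _ (Set.mem_univ x)]; simp⟩⟩
  have hsimple : ∀ (s : SimpleFunc E ℂ) (x : E), ∫ y, s y ∂(S x) = L (ofSimple w s) x := by
    intro s x
    induction s using SimpleFunc.induction with
    | @const c A hA =>
      have e1 : ofSimple w (SimpleFunc.piecewise A hA (SimpleFunc.const E c)
          (SimpleFunc.const E 0)) = c • ind w A hA := WBounded.ext fun y => by
        rw [WBounded.smul_apply, ofSimple_apply]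
        by_cases hy : y ∈ A
        · rw [ind_of_mem hA hy]; simp [hy]
        · rw [ind_of_notMem hA hy]; simp [hy]
      have e2 : (L (ind w A hA) x) = (((L (ind w A hA) x).re : ℝ) : ℂ) :=
        Complex.ext rfl (by rw [hp.im_eq_zero (ind_im hA) x]; simp)
      rw [e1, map_smul, WBounded.smul_apply, e2]
      have e3 : (S x).real A = (L (ind w A hA) x).re := by
        rw [measureReal_def, hS x A hA, ENNReal.toReal_ofReal (hp _ (ind_re_nonneg hA) x)]
      rw [← e3]
      have e4 : ∀ y, (SimpleFunc.piecewise A hA (SimpleFunc.const E c)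
          (SimpleFunc.const E 0)) y = A.indicator (fun _ => c) y := fun y => by
        by_cases hy : y ∈ A <;> simp [hy]
      simp only [e4]
      rw [integral_indicator hA, setIntegral_const, Complex.real_smul, mul_comm]
    | @add f g hfg hf hg =>
      have e1 : ofSimple w (f + g) = ofSimple w f + ofSimple w g := WBounded.ext fun y => rfl
      rw [e1, map_add, WBounded.add_apply, ← hf, ← hg]
      exact integral_add (SimpleFunc.integrable_of_isFiniteMeasure f)
        (SimpleFunc.integrable_of_isFiniteMeasure g)
  have hint : ∀ (f : WBounded w) (x : E), Integrable f (S x) → ∫ y, f y ∂(S x) = L f x := by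
    intro f x hf
    have h2 : Tendsto (fun k => ∫ y, f.approx k y ∂(S x)) atTop (𝓝 (∫ y, f y ∂(S x))) := by
      refine tendsto_integral_of_dominated_convergence (fun y => 2 * ‖f y‖)
        (fun k => (f.approx k).measurable.aestronglyMeasurable) (hf.norm.const_mul 2)
        (fun k => Eventually.of_forall (f.norm_approx_le k)) (Eventually.of_forall f.tendsto_approx)
    have h3 := hs (fun k => ofSimple w (f.approx k)) f _ f.norm_ofSimple_approx_le
      f.tendsto_approx x
    refine tendsto_nhds_unique h2 (h3.congr fun k => (hsimple _ x).symm)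
  -- Integrability of `w` is not yet known, so the representation is applied to the truncations
  -- min(w, k); positivity bounds their integrals by `L w`, and monotone convergence concludes with
  -- constant ‖L‖.
  have hacts : ActsOn S w := by
    refine ⟨‖L‖₊, fun x => ?_⟩
    let g : ℕ → WBounded w := fun k => ofBounded w (fun y => ((min (w y) k : ℝ) : ℂ))
      (Complex.measurable_ofReal.comp (w.measurable'.min measurable_const)) ⟨k, fun y => by
        rw [Complex.norm_real, Real.norm_of_nonneg (le_min (w.pos y).le (Nat.cast_nonneg k))]
        exact min_le_right _ _⟩
    have hg : ∀ k y, g k y = ((min (w y) k : ℝ) : ℂ) := fun k y => rfl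
    have hle : ∀ k : ℕ, ∫⁻ y, ENNReal.ofReal (min (w y) k) ∂(S x) ≤
        ‖L‖₊ * ENNReal.ofReal (w x) := by
      intro k
      have hbd : ∀ y, ‖min (w y) (k : ℝ)‖ ≤ k := fun y => by
        rw [Real.norm_of_nonneg (le_min (w.pos y).le (Nat.cast_nonneg k))]
        exact min_le_right _ _
      have hmi : Integrable (fun y => min (w y) (k : ℝ)) (S x) :=
        Integrable.of_bound (w.measurable'.min measurable_const).aestronglyMeasurable k
          (Eventually.of_forall hbd)
      rw [← ofReal_integral_eq_lintegral_ofReal hmi (Eventually.of_forall fun y =>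
        le_min (w.pos y).le (Nat.cast_nonneg k))]
      have e1 := hint (g k) x hmi.ofReal
      simp only [hg] at e1
      rw [integral_complex_ofReal] at e1
      have e2 : ∫ y, min (w y) (k : ℝ) ∂(S x) = (L (g k) x).re := by rw [← e1]; simp
      rw [e2, ← enorm_eq_nnnorm, ← ofReal_norm, ← ENNReal.ofReal_mul (norm_nonneg _)]
      refine ENNReal.ofReal_le_ofReal ?_
      calc (L (g k) x).re ≤ (L (weight w) x).re := hp.mono (fun y => by
            rw [hg, weight_apply, Complex.ofReal_re, Complex.ofReal_re]; exact min_le_left _ _) x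
        _ ≤ ‖L (weight w) x‖ := Complex.re_le_norm _
        _ ≤ ‖L (weight w)‖ * w x := norm_apply_le _ x
        _ ≤ ‖L‖ * w x := mul_le_mul_of_nonneg_right
            ((L.le_opNorm _).trans (mul_le_of_le_one_right (norm_nonneg _) norm_weight_le))
            (w.pos x).le
    refine le_of_tendsto' (lintegral_tendsto_of_tendsto_of_monotone
      (f := fun k y => ENNReal.ofReal (min (w y) (k : ℕ)))
      (fun k => (w.measurable'.min measurable_const).ennreal_ofReal.aemeasurable)
      (Eventually.of_forall fun y => ?_) (Eventually.of_forall fun y => ?_)) hle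
    · intro k l hkl
      exact ENNReal.ofReal_le_ofReal (min_le_min_left _ (Nat.cast_le.2 hkl))
    · refine tendsto_const_nhds.congr' ?_
      filter_upwards [eventually_ge_atTop ⌈w y⌉₊] with k hk
      rw [min_eq_left ((Nat.le_ceil _).trans (Nat.cast_le.2 hk))]
  exact ⟨S, hacts, hM, ContinuousLinearMap.ext fun f => WBounded.ext fun x =>
    hint f x (hacts.integrable f x)⟩

end Representation

theorem kernelOp_one {P : Kernel E E} [IsMarkovKernel P] (h : ActsOn P w) :
    kernelOp P w h (ind w Set.univ MeasurableSet.univ) = ind w Set.univ MeasurableSet.univ := by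
  refine WBounded.ext fun x => ?_
  rw [kernelOp_apply, ind_of_mem _ (Set.mem_univ x)]
  simp only [ind_of_mem _ (Set.mem_univ _)]
  simp

/-- A finite-rank Markov kernel maps `𝓑_w` into the bounded functions. -/
theorem kernelOp_mem_boundedFunctions {S : Kernel E E} [IsMarkovKernel S] (h : ActsOn S w)
    [hfin : FiniteDimensional ℂ (kernelOp S w h).range] (f : WBounded w) :
    kernelOp S w h f ∈ boundedFunctions w := by
  set T := kernelOp S w h
  -- The image of the bounded functions is finite-dimensional, so it contains the subsequential
  -- limit of the images of simple approximations, which is `T f`.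
  let V : Submodule ℂ (WBounded w) := (boundedFunctions w).map (T : WBounded w →ₗ[ℂ] WBounded w)
  have hVF : V ≤ T.range := by
    rintro _ ⟨g, -, rfl⟩
    exact ⟨g, rfl⟩
  have : FiniteDimensional ℂ V := Submodule.finiteDimensional_of_le hVF
  obtain ⟨u, hu, φ, hφ, hlim⟩ := exists_tendsto_subseq_of_mem V
    (v := fun k => T (ofSimple w (f.approx k))) (fun k => ⟨_, ofSimple_mem _, rfl⟩)
    (M := ‖T‖ * (2 * ‖f‖)) (fun k => (T.le_opNorm _).trans
      (mul_le_mul_of_nonneg_left (f.norm_ofSimple_approx_le k) (norm_nonneg _)))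
  have hu' : T f = u := WBounded.ext fun x => by
    have h1 := sigmaContinuous_kernelOp h (fun k => ofSimple w (f.approx k)) f _
      f.norm_ofSimple_approx_le f.tendsto_approx x
    exact tendsto_nhds_unique (h1.comp hφ.tendsto_atTop) (tendsto_apply hlim x)
  obtain ⟨g, ⟨M, hM⟩, hg⟩ := hu
  rw [hu', ← hg]
  exact ⟨M, fun x => by simpa using norm_kernelOp_pow_apply_le h hM 1 x⟩

/-! ### Kernels evaluated on sets -/

theorem isMarkovKernel_pow (P : Kernel E E) [IsMarkovKernel P] (n : ℕ) :
    IsMarkovKernel (P ^ n) := by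
  induction n with
  | zero => exact inferInstanceAs (IsMarkovKernel Kernel.id)
  | succ n ih => exact inferInstanceAs (IsMarkovKernel ((P ^ n) ∘ₖ P))

theorem kernelOp_ind_apply {Q : Kernel E E} (h : ActsOn Q w) {A : Set E} (hA : MeasurableSet A)
    (x : E) : kernelOp Q w h (ind w A hA) x = ((Q x).real A : ℂ) := by
  rw [kernelOp_apply]
  change ∫ y, A.indicator (fun _ => (1 : ℂ)) y ∂(Q x) = _
  rw [integral_indicator hA, setIntegral_const, Complex.real_smul, mul_one]

theorem integral_real_apply (Q₁ Q₂ : Kernel E E) [IsMarkovKernel Q₂] {A : Set E}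
    (hA : MeasurableSet A) (x : E) :
    ∫ y, ((Q₂ y).real A : ℂ) ∂(Q₁ x) = (((Q₂ ∘ₖ Q₁) x).real A : ℂ) := by
  rw [integral_complex_ofReal]
  congr 1
  simp only [measureReal_def]
  rw [integral_toReal (Q₂.measurable_coe hA).aemeasurable
    (Eventually.of_forall fun y => measure_lt_top _ _), Kernel.comp_apply' _ _ _ hA]

theorem kernelOp_kernelOp_ind_apply {Q₁ Q₂ : Kernel E E} [IsMarkovKernel Q₂] (h₁ : ActsOn Q₁ w)
    (h₂ : ActsOn Q₂ w) {A : Set E} (hA : MeasurableSet A) (x : E) :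
    kernelOp Q₁ w h₁ (kernelOp Q₂ w h₂ (ind w A hA)) x = (((Q₂ ∘ₖ Q₁) x).real A : ℂ) := by
  rw [kernelOp_apply]
  simp only [kernelOp_ind_apply]
  exact integral_real_apply Q₁ Q₂ hA x

theorem kernelOp_pow_ind_apply {P : Kernel E E} [IsMarkovKernel P] (h : ActsOn P w) {A : Set E}
    (hA : MeasurableSet A) (n : ℕ) (x : E) :
    (kernelOp P w h ^ n) (ind w A hA) x = (((P ^ n) x).real A : ℂ) := by
  induction n generalizing x with
  | zero =>
    change ind w A hA x = ((Kernel.id x).real A : ℂ)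
    rw [Kernel.id_apply, measureReal_def, Measure.dirac_apply' _ hA]
    by_cases hx : x ∈ A
    · rw [ind_of_mem hA hx]; simp [hx]
    · rw [ind_of_notMem hA hx]; simp [hx]
  | succ n ih =>
    have := isMarkovKernel_pow P n
    rw [pow_succ', mul_apply_eq_comp, kernelOp_apply]
    simp only [ih]
    rw [integral_real_apply P (P ^ n) hA, pow_succ]
    rfl

theorem comp_eq_comp_of_kernelOp_commute {P S : Kernel E E} [IsMarkovKernel P] [IsMarkovKernel S]
    {hP : ActsOn P w} {hS : ActsOn S w}
    (hc : kernelOp P w hP * kernelOp S w hS = kernelOp S w hS * kernelOp P w hP) :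
    P ∘ₖ S = S ∘ₖ P := by
  ext x A hA
  have h1 : kernelOp P w hP (kernelOp S w hS (ind w A hA)) x =
      kernelOp S w hS (kernelOp P w hP (ind w A hA)) x :=
    congrArg (fun f : WBounded w => f x) (DFunLike.congr_fun hc (ind w A hA))
  rw [kernelOp_kernelOp_ind_apply, kernelOp_kernelOp_ind_apply] at h1
  have h2 : ((S ∘ₖ P) x).real A = ((P ∘ₖ S) x).real A := by exact_mod_cast h1
  exact ((measureReal_eq_measureReal_iff).1 h2).symm

/-- A set that the chain never leaves in one step is never left. -/
theorem pow_apply_compl_eq_zero {P : Kernel E E} {A : Set E} (hA : MeasurableSet A)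
    (h : ∀ x ∈ A, P x Aᶜ = 0) (n : ℕ) : ∀ x ∈ A, (P ^ n) x Aᶜ = 0 := by
  induction n with
  | zero =>
    intro x hx
    change Kernel.id x Aᶜ = 0
    rw [Kernel.id_apply, Measure.dirac_apply' _ hA.compl]
    simp [hx]
  | succ n ih =>
    intro x hx
    rw [add_comm, Kernel.pow_add_apply_eq_lintegral _ _ _ _ hA.compl, pow_one]
    rw [lintegral_eq_zero_iff ((P ^ n).measurable_coe hA.compl)]
    filter_upwards [(measure_eq_zero_iff_ae_notMem.1 (h x hx))] with y hy
    exact ih y (by simpa using hy)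

/-- From a point of `A` the complement is never reached, so irreducibility forbids it positive
measure. -/
theorem measure_compl_eq_zero_of_absorbing {P : Kernel E E} {φ : Measure E}
    (hφ : IsIrreducibilityMeasure P φ) {A : Set E} (hA : MeasurableSet A)
    (h : ∀ x ∈ A, P x Aᶜ = 0) (hne : A.Nonempty) : φ Aᶜ = 0 := by
  by_contra hpos
  obtain ⟨x, hx⟩ := hne
  obtain ⟨n, hn⟩ := hφ.2.irreducible hA.compl (pos_iff_ne_zero.2 hpos) x
  exact hn.ne' (pow_apply_compl_eq_zero hA h n x hx)

/-- A set that is null for all `S x` can be avoided on an absorbing set of full `S x`-measure. -/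
theorem exists_absorbing_subset_compl {P S : Kernel E E} (hc : P ∘ₖ S = S ∘ₖ P) {N : Set E}
    (hN : MeasurableSet N) (hSN : ∀ x, S x N = 0) :
    ∃ A : Set E, MeasurableSet A ∧ (∀ x ∈ A, x ∉ N) ∧ (∀ x ∈ A, P x Aᶜ = 0) ∧
      ∀ x, S x Aᶜ = 0 := by
  have hmeas : ∀ n, MeasurableSet {x | (P ^ n) x N = 0} := fun n =>
    (P ^ n).measurable_coe hN (measurableSet_singleton 0)
  have hcomm : ∀ n, (P ^ n) ∘ₖ S = S ∘ₖ (P ^ n) := fun n =>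
    ((show Commute P S from hc).pow_left n).eq
  -- The points from which `N` is almost surely never visited. Time n = 0 keeps them outside `N`,
  -- the shift n + 1 gives absorption, and commutation with `S` gives full measure.
  refine ⟨⋂ n, {x | (P ^ n) x N = 0}, MeasurableSet.iInter hmeas, fun x hx hxN => ?_,
    fun x hx => ?_, fun x => ?_⟩
  · have h0 : Kernel.id x N = 0 := Set.mem_iInter.1 hx 0
    rw [Kernel.id_apply, Measure.dirac_apply' _ hN] at h0
    simp [hxN] at h0
  · rw [Set.compl_iInter, measure_iUnion_null_iff]
    intro n
    have h1 : (P ^ (n + 1)) x N = 0 := Set.mem_iInter.1 hx (n + 1)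
    rw [add_comm, Kernel.pow_add_apply_eq_lintegral _ _ _ _ hN, pow_one,
      lintegral_eq_zero_iff ((P ^ n).measurable_coe hN)] at h1
    exact h1
  · rw [Set.compl_iInter, measure_iUnion_null_iff]
    intro n
    have h1 : ((P ^ n) ∘ₖ S) x N = 0 := by
      rw [hcomm, Kernel.comp_apply' _ _ _ hN]
      simp [hSN]
    rw [Kernel.comp_apply' _ _ _ hN, lintegral_eq_zero_iff ((P ^ n).measurable_coe hN)] at h1
    exact h1

/-! ### Eigenfunctions of modulus one -/

/-- The variance identity. With ν = P x it turns equality in |Pf|² ≤ P|f|² into `f` being constant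
almost surely. -/
theorem integral_norm_sub_integral_sq {ν : Measure E} [IsProbabilityMeasure ν] {f : E → ℂ}
    (hf : Measurable f) {M : ℝ} (hM : ∀ x, ‖f x‖ ≤ M) :
    ∫ y, ‖f y - ∫ z, f z ∂ν‖ ^ 2 ∂ν = ∫ y, ‖f y‖ ^ 2 ∂ν - ‖∫ z, f z ∂ν‖ ^ 2 := by
  set c := ∫ z, f z ∂ν with hc
  have hfi : Integrable f ν := Integrable.of_bound hf.aestronglyMeasurable M
    (Eventually.of_forall hM)
  have hf2 : Integrable (fun y => ‖f y‖ ^ 2) ν :=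
    Integrable.of_bound (hf.norm.pow_const 2).aestronglyMeasurable (M ^ 2)
      (Eventually.of_forall fun y => by
        rw [Real.norm_of_nonneg (by positivity)]
        exact pow_le_pow_left₀ (norm_nonneg _) (hM y) 2)
  have hcf : Integrable (fun y => (f y * (starRingEnd ℂ) c).re) ν :=
    (hfi.mul_const ((starRingEnd ℂ) c)).re
  have hcfi : ∫ y, (f y * (starRingEnd ℂ) c).re ∂ν = ‖c‖ ^ 2 := by
    have h1 := Complex.reCLM.integral_comp_comm (hfi.mul_const ((starRingEnd ℂ) c))
    rw [integral_mul_const, ← hc, Complex.mul_conj] at h1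
    rw [Complex.normSq_eq_norm_sq] at h1
    exact h1
  have hpt : ∀ y, ‖f y - c‖ ^ 2 = ‖f y‖ ^ 2 - 2 * (f y * (starRingEnd ℂ) c).re + ‖c‖ ^ 2 := by
    intro y
    simp only [← Complex.normSq_eq_norm_sq, Complex.normSq_sub]
    ring
  have hsub : Integrable (fun y => ‖f y‖ ^ 2 - 2 * (f y * (starRingEnd ℂ) c).re) ν :=
    hf2.sub (hcf.const_mul 2)
  simp only [hpt]
  rw [integral_add hsub (integrable_const _),
    integral_sub hf2 (hcf.const_mul 2), integral_const_mul, hcfi]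
  simp
  ring

/-- Along the subsequence |μ| ^ φ j·‖f‖ tends to ‖f‖ ≠ 0, which excludes both decay and growth. -/
theorem norm_eigenvalue_eq_one {B : Type*} [NormedAddCommGroup B] [NormedSpace ℂ B]
    {T L : B →L[ℂ] B} {φ : ℕ → ℕ} (hφ : StrictMono φ)
    (hlim : Tendsto (fun j => T ^ φ j) atTop (𝓝 L)) {f : B} (hf0 : f ≠ 0) (hLf : L f = f) {μ : ℂ}
    (hTf : T f = μ • f) : ‖μ‖ = 1 := by
  have h1 : Tendsto (fun j => ‖μ‖ ^ φ j * ‖f‖) atTop (𝓝 ‖f‖) := by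
    have h2 := ((ContinuousLinearMap.apply ℂ B f).continuous.tendsto _).comp hlim
    have h3 := h2.norm
    change Tendsto (fun j => ‖(T ^ φ j) f‖) atTop (𝓝 ‖L f‖) at h3
    simpa only [pow_apply_of_eigenvector hTf, norm_smul, norm_pow, hLf] using h3
  have hf : 0 < ‖f‖ := norm_pos_iff.2 hf0
  have h4 : Tendsto (fun j => ‖μ‖ ^ φ j) atTop (𝓝 1) := by
    have := h1.mul_const ‖f‖⁻¹
    simpa [mul_assoc, hf.ne'] using this
  rcases lt_trichotomy ‖μ‖ 1 with h | h | h
  · have h5 := (tendsto_pow_atTop_nhds_zero_of_lt_one (norm_nonneg μ) h).comp hφ.tendsto_atTop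
    exact absurd (tendsto_nhds_unique h4 h5) one_ne_zero
  · exact h
  · have h5 := (tendsto_pow_atTop_atTop_of_one_lt h).comp hφ.tendsto_atTop
    exact absurd h4 (not_tendsto_nhds_of_tendsto_atTop h5 1)

/-- An `S`-invariant function vanishing on a set of full measure for all `S x` vanishes. -/
theorem exists_mem_apply_ne_zero {S : Kernel E E} {hS : ActsOn S w} {A : Set E}
    (hAS : ∀ x, S x Aᶜ = 0) {f : WBounded w} (hf0 : f ≠ 0) (hSf : kernelOp S w hS f = f) : ∃ x ∈ A, f x ≠ 0 := by
  by_contra! hz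
  refine hf0 (WBounded.ext fun x => ?_)
  rw [← hSf, kernelOp_apply, WBounded.zero_apply]
  refine integral_eq_zero_of_ae ?_
  filter_upwards [measure_eq_zero_iff_ae_notMem.1 (hAS x)] with y hy
  exact hz y (by simpa using hy)

section Eigenfunctions

variable {P S : Kernel E E} [IsMarkovKernel P] [IsMarkovKernel S] {hP : ActsOn P w}
  {hS : ActsOn S w} {φ : ℕ → ℕ}

/-- A bounded eigenfunction of modulus one evolves deterministically on an absorbing set of full
measure for all `S x`. -/
theorem exists_absorbing_eigenfunction (hφ : StrictMono φ)
    (hlim : Tendsto (fun j => kernelOp P w hP ^ φ j) atTop (𝓝 (kernelOp S w hS)))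
    (hSS : kernelOp S w hS * kernelOp S w hS = kernelOp S w hS)
    (hc : kernelOp P w hP * kernelOp S w hS = kernelOp S w hS * kernelOp P w hP)
    {f : WBounded w} (hfb : f ∈ boundedFunctions w) {μ : ℂ} (hμ : ‖μ‖ = 1)
    (hPf : kernelOp P w hP f = μ • f) :
    ∃ A : Set E, MeasurableSet A ∧ (∀ x ∈ A, P x Aᶜ = 0) ∧ (∀ x, S x Aᶜ = 0) ∧
      ∀ x ∈ A, ∀ᵐ y ∂(P x), f y = μ * f x := by
  set T := kernelOp P w hP with hT
  set L := kernelOp S w hS with hL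
  obtain ⟨M, hM⟩ := hfb
  let h : WBounded w := ofBounded w (fun y => ((‖f y‖ ^ 2 : ℝ) : ℂ))
    (Complex.measurable_ofReal.comp (f.measurable.norm.pow_const 2)) ⟨M ^ 2, fun y => by
      rw [Complex.norm_real, Real.norm_of_nonneg (by positivity)]
      exact pow_le_pow_left₀ (norm_nonneg _) (hM y) 2⟩
  have hh : ∀ y, (h y).re = ‖f y‖ ^ 2 := fun y => Complex.ofReal_re _
  have hvar : ∀ x, ∫ y, ‖f y - μ * f x‖ ^ 2 ∂(P x) = (T h x).re - (h x).re := by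
    intro x
    have h1 : ∫ y, f y ∂(P x) = μ * f x := by
      rw [← kernelOp_apply P w hP, ← hT, hPf, WBounded.smul_apply]
    have h2 := integral_norm_sub_integral_sq (ν := P x) f.measurable hM
    rw [h1] at h2
    rw [h2, hT, re_kernelOp_apply, norm_mul, hμ, one_mul, hh]
    simp only [hh]
  have hsub : ∀ x, (h x).re ≤ (T h x).re := fun x => by
    rw [← sub_nonneg, ← hvar]
    exact integral_nonneg fun y => by positivity
  have hTp : RePositive T := rePositive_kernelOp hP
  have hLp : RePositive L := rePositive_kernelOp hS
  have hcf : ∀ g, T (L g) = L (T g) := fun g => DFunLike.congr_fun hc g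
  have hstep : ∀ x, (L h x).re ≤ (T (L h) x).re := fun x => by
    rw [hcf]
    exact hLp.mono hsub x
  have hmono : ∀ x, Monotone fun n => ((T ^ n) (L h) x).re := fun x =>
    monotone_nat_of_le_succ fun n => by
      rw [pow_succ]
      exact (hTp.pow n).mono hstep x
  -- The sequence TⁿLh increases from Lh, yet returns to LLh = Lh along φ, so it is constant.
  have heq : ∀ x, (T (L h) x).re ≤ (L h x).re := by
    intro x
    have h1 : Tendsto (fun j => ((T ^ φ j) (L h) x).re) atTop (𝓝 (L h x).re) := by
      have h2 := (Complex.continuous_re.tendsto _).comp (tendsto_apply_apply hlim (L h) x)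
      have h3 : L (L h) = L h := DFunLike.congr_fun hSS h
      rwa [h3] at h2
    refine ge_of_tendsto h1 ?_
    filter_upwards [hφ.tendsto_atTop.eventually_ge_atTop 1] with j hj
    exact hmono x hj
  -- The non-negative defect Th - h has `S x`-integral (TLh - Lh)(x) = 0, so `N` is null for every
  -- `S x`.
  let N : Set E := {x | (T h x).re - (h x).re ≠ 0}
  have hDm : Measurable fun x => (T h x).re - (h x).re :=
    (Complex.measurable_re.comp (T h).measurable).sub (Complex.measurable_re.comp h.measurable)
  have hNm : MeasurableSet N := (hDm (measurableSet_singleton 0)).compl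
  have hSN : ∀ x, S x N = 0 := by
    intro x
    have i1 : Integrable (fun y => (T h y).re) (S x) := (hS.integrable (T h) x).re
    have i2 : Integrable (fun y => (h y).re) (S x) := (hS.integrable h x).re
    have h1 : ∫ y, ((T h y).re - (h y).re) ∂(S x) = 0 := by
      rw [integral_sub i1 i2, ← re_kernelOp_apply hS, ← re_kernelOp_apply hS, ← hL, ← hcf,
        le_antisymm (heq x) (hstep x), sub_self]
    have h2 := (integral_eq_zero_iff_of_nonneg (fun y => sub_nonneg.2 (hsub y)) (i1.sub i2)).1 h1
    exact h2
  obtain ⟨A, hAm, hAN, hAP, hAS⟩ :=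
    exists_absorbing_subset_compl (comp_eq_comp_of_kernelOp_commute hc) hNm hSN
  refine ⟨A, hAm, hAP, hAS, fun x hx => ?_⟩
  have h0 : ∫ y, ‖f y - μ * f x‖ ^ 2 ∂(P x) = 0 := by
    rw [hvar]
    exact not_not.1 (hAN x hx)
  have hint : Integrable (fun y => ‖f y - μ * f x‖ ^ 2) (P x) :=
    Integrable.of_bound ((f.measurable.sub_const _).norm.pow_const 2).aestronglyMeasurable
      ((M + ‖μ * f x‖) ^ 2) (Eventually.of_forall fun y => by
        rw [Real.norm_of_nonneg (by positivity)]
        exact pow_le_pow_left₀ (norm_nonneg _)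
          ((norm_sub_le _ _).trans (add_le_add_left (hM y) _)) 2)
  filter_upwards [(integral_eq_zero_iff_of_nonneg (fun y => by positivity) hint).1 h0] with y hy
  have h1 : ‖f y - μ * f x‖ = 0 := by simpa using hy
  exact sub_eq_zero.1 (norm_eq_zero.1 h1)

/-- The eigenvalues of `P` on the range of `S` are roots of unity. -/
theorem exists_pow_eigenvalue_eq_one (hφ : StrictMono φ)
    (hlim : Tendsto (fun j => kernelOp P w hP ^ φ j) atTop (𝓝 (kernelOp S w hS)))
    (hSS : kernelOp S w hS * kernelOp S w hS = kernelOp S w hS)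
    (hc : kernelOp P w hP * kernelOp S w hS = kernelOp S w hS * kernelOp P w hP)
    [FiniteDimensional ℂ (kernelOp S w hS).range]
    {f : WBounded w} (hf0 : f ≠ 0) (hSf : kernelOp S w hS f = f) {μ : ℂ}
    (hPf : kernelOp P w hP f = μ • f) : ∃ k : ℕ, k ≠ 0 ∧ μ ^ k = 1 := by
  have hμ := norm_eigenvalue_eq_one hφ hlim hf0 hSf hPf
  have hfb : f ∈ boundedFunctions w := hSf ▸ kernelOp_mem_boundedFunctions hS f
  obtain ⟨A, hAm, hAP, hAS, hAf⟩ :=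
    exists_absorbing_eigenfunction hφ hlim hSS hc hfb hμ hPf
  obtain ⟨x₀, hx₀, hfx₀⟩ := exists_mem_apply_ne_zero hAS hf0 hSf
  obtain ⟨M, hM⟩ := hfb
  set T := kernelOp P w hP with hT
  set L := kernelOp S w hS with hL
  let F : ℕ → WBounded w := fun k => ofBounded w (fun y => f y ^ k) (f.measurable.pow_const k)
    ⟨M ^ k, fun y => by
      rw [norm_pow]
      exact pow_le_pow_left₀ (norm_nonneg _) (hM y) k⟩
  have hF : ∀ k y, F k y = f y ^ k := fun k y => rfl
  have hTF : ∀ k n, ∀ x ∈ A, (T ^ n) (F k) x = (μ ^ k) ^ n * F k x := by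
    intro k n
    induction n with
    | zero => intro x _; simp
    | succ n ih =>
      intro x hx
      rw [pow_succ' T, mul_apply_eq_comp, hT, kernelOp_apply, ← hT]
      have h1 : ∀ᵐ y ∂(P x), (T ^ n) (F k) y = (μ ^ k) ^ (n + 1) * F k x := by
        filter_upwards [hAf x hx, measure_eq_zero_iff_ae_notMem.1 (hAP x hx)] with y hy hyA
        rw [ih y (by simpa using hyA), hF, hF, hy, mul_pow, pow_succ]
        ring
      rw [integral_congr_ae h1]
      simp
  have hcf : ∀ g, T (L g) = L (T g) := fun g => DFunLike.congr_fun hc g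
  have hTv : ∀ k, T (L (F k)) = μ ^ k • L (F k) := by
    intro k
    rw [hcf, ← map_smul]
    refine WBounded.ext fun x => ?_
    rw [hL, kernelOp_apply, kernelOp_apply]
    refine integral_congr_ae ?_
    filter_upwards [measure_eq_zero_iff_ae_notMem.1 (hAS x)] with y hy
    have h1 := hTF k 1 y (by simpa using hy)
    rw [pow_one, pow_one] at h1
    rw [h1, WBounded.smul_apply]
  -- At `x₀` the modulus of TⁿF(k) does not depend on n, so it survives in the limit.
  have hv0 : ∀ k, L (F k) ≠ 0 := by
    intro k hk
    have h1 := (tendsto_apply_apply hlim (F k) x₀).norm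
    simp only [hTF k _ x₀ hx₀, norm_mul, norm_pow, hμ, one_pow, one_mul] at h1
    have h2 := tendsto_nhds_unique h1 tendsto_const_nhds
    rw [hk, WBounded.zero_apply, norm_zero, hF, norm_pow] at h2
    exact pow_ne_zero k (norm_ne_zero_iff.2 hfx₀) h2.symm
  have hfin := finite_eigenvalues_on T (V := L.range) (by
    rintro _ ⟨g, rfl⟩
    exact ⟨T g, (hcf g).symm⟩)
  have hmem : ∀ k : ℕ, μ ^ k ∈ {ν : ℂ | ∃ v ∈ L.range, v ≠ 0 ∧ T v = ν • v} := fun k =>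
    ⟨L (F k), ⟨F k, rfl⟩, hv0 k, hTv k⟩
  have : Finite {ν : ℂ | ∃ v ∈ L.range, v ≠ 0 ∧ T v = ν • v} := hfin
  obtain ⟨a, b, hab, heq⟩ := Finite.exists_ne_map_eq_of_infinite
    fun k : ℕ => (⟨μ ^ k, hmem k⟩ : {ν : ℂ | ∃ v ∈ L.range, v ≠ 0 ∧ T v = ν • v})
  have heq' : μ ^ a = μ ^ b := congrArg Subtype.val heq
  have hμ0 : μ ≠ 0 := fun h => by simp [h] at hμ
  wlog hlt : a < b generalizing a b
  · exact this b a hab.symm heq.symm heq'.symm (lt_of_le_of_ne (not_lt.1 hlt) hab.symm)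
  refine ⟨b - a, by omega, ?_⟩
  rw [pow_sub₀ _ hμ0 hlt.le, ← heq', mul_inv_cancel₀ (pow_ne_zero a hμ0)]

/-- The eigenvalues of an irreducible aperiodic kernel on the range of `S` are trivial. -/
theorem eigenvalue_eq_one_of_aperiodic (hφ : StrictMono φ)
    (hlim : Tendsto (fun j => kernelOp P w hP ^ φ j) atTop (𝓝 (kernelOp S w hS)))
    (hSS : kernelOp S w hS * kernelOp S w hS = kernelOp S w hS)
    (hc : kernelOp P w hP * kernelOp S w hS = kernelOp S w hS * kernelOp P w hP)
    [FiniteDimensional ℂ (kernelOp S w hS).range] (hap : IsAperiodicKernel P)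
    {f : WBounded w} (hf0 : f ≠ 0) (hSf : kernelOp S w hS f = f) {μ : ℂ}
    (hPf : kernelOp P w hP f = μ • f) : μ = 1 := by
  have hμ := norm_eigenvalue_eq_one hφ hlim hf0 hSf hPf
  have hfb : f ∈ boundedFunctions w := hSf ▸ kernelOp_mem_boundedFunctions hS f
  obtain ⟨A, hAm, hAP, hAS, hAf⟩ :=
    exists_absorbing_eigenfunction hφ hlim hSS hc hfb hμ hPf
  obtain ⟨x₀, hx₀, hfx₀⟩ := exists_mem_apply_ne_zero hAS hf0 hSf
  obtain ⟨k, hk0, hk⟩ := exists_pow_eigenvalue_eq_one hφ hlim hSS hc hf0 hSf hPf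
  have hm : 0 < orderOf μ :=
    orderOf_pos_iff.2 (isOfFinOrder_iff_pow_eq_one.2 ⟨k, Nat.pos_of_ne_zero hk0, hk⟩)
  have : NeZero (orderOf μ) := ⟨hm.ne'⟩
  -- Each step multiplies `f` by μ, so it moves one level set to the next; the levels are distinct
  -- because `f x₀ ≠ 0` and the exponents stay below the order.
  let D : ZMod (orderOf μ) → Set E := fun i => A ∩ {y | f y = μ ^ i.val * f x₀}
  have hDm : ∀ i, MeasurableSet (D i) := fun i =>
    hAm.inter (f.measurable (measurableSet_singleton _))
  have hval : ∀ i : ZMod (orderOf μ), μ ^ (i + 1).val = μ * μ ^ i.val := by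
    intro i
    rw [← pow_succ', ZMod.val_add, pow_mod_orderOf, pow_add, pow_succ]
    congr 1
    rw [ZMod.val_one_eq_one_mod, pow_mod_orderOf, pow_one]
  have hDP : ∀ i, ∀ x ∈ D i, P x (D (i + 1))ᶜ = 0 := by
    rintro i x ⟨hxA, hxf⟩
    rw [measure_eq_zero_iff_ae_notMem]
    filter_upwards [hAf x hxA, measure_eq_zero_iff_ae_notMem.1 (hAP x hxA)] with y hy hyA
    rw [Set.notMem_compl_iff]
    refine ⟨by simpa using hyA, ?_⟩
    change f y = _
    rw [hy, hval, show f x = _ from hxf, mul_assoc]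
  have hcycle : IsCycle P (orderOf μ) D := by
    refine ⟨hDm, fun i j hij => ?_, fun i x hx => ?_, fun ψ hψ => ?_⟩
    · rw [Set.disjoint_left]
      rintro y ⟨-, hyi⟩ ⟨-, hyj⟩
      have h1 : μ ^ i.val * f x₀ = μ ^ j.val * f x₀ := hyi.symm.trans hyj
      exact hij (ZMod.val_injective _
        (pow_injOn_Iio_orderOf (ZMod.val_lt i) (ZMod.val_lt j) (mul_right_cancel₀ hfx₀ h1)))
    · exact (prob_compl_eq_zero_iff (hDm (i + 1))).1 (hDP i x hx)
    · refine measure_compl_eq_zero_of_absorbing hψ (MeasurableSet.iUnion hDm) ?_ ?_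
      · intro x hx
        obtain ⟨i, hi⟩ := Set.mem_iUnion.1 hx
        exact measure_mono_null (Set.compl_subset_compl.2 (Set.subset_iUnion D (i + 1)))
          (hDP i x hi)
      · exact ⟨x₀, Set.mem_iUnion.2 ⟨0, hx₀, by simp⟩⟩
  exact orderOf_eq_one_iff.1 (hap _ hm ⟨D, hcycle⟩)

/-- Harmonic functions in the range of `S` are constant when `P` is irreducible. -/
theorem apply_eq_apply_of_irreducible (hφ : StrictMono φ)
    (hlim : Tendsto (fun j => kernelOp P w hP ^ φ j) atTop (𝓝 (kernelOp S w hS)))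
    (hSS : kernelOp S w hS * kernelOp S w hS = kernelOp S w hS)
    (hc : kernelOp P w hP * kernelOp S w hS = kernelOp S w hS * kernelOp P w hP)
    [FiniteDimensional ℂ (kernelOp S w hS).range] (hirr : IsIrreducibleKernel P)
    {f : WBounded w} (hSf : kernelOp S w hS f = f) (hPf : kernelOp P w hP f = f) (x y : E) :
    f x = f y := by
  have hfb : f ∈ boundedFunctions w := hSf ▸ kernelOp_mem_boundedFunctions hS f
  obtain ⟨A, hAm, hAP, hAS, hAf⟩ := exists_absorbing_eigenfunction (μ := 1) hφ hlim hSS hc hfb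
    norm_one (by rw [hPf, one_smul])
  obtain ⟨ψ, hψ⟩ := hirr
  let D : E → Set E := fun x => A ∩ {y | f y = f x}
  have hD : ∀ x ∈ A, ψ (D x)ᶜ = 0 := by
    intro x hx
    refine measure_compl_eq_zero_of_absorbing hψ
      (hAm.inter (f.measurable (measurableSet_singleton _))) ?_ ⟨x, hx, rfl⟩
    rintro y ⟨hyA, hyf⟩
    rw [measure_eq_zero_iff_ae_notMem]
    filter_upwards [hAf y hyA, measure_eq_zero_iff_ae_notMem.1 (hAP y hyA)] with z hz hzA
    rw [Set.notMem_compl_iff]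
    refine ⟨by simpa using hzA, ?_⟩
    change f z = f x
    rw [hz, one_mul]
    exact hyf
  -- Two different level sets would be disjoint and both of full ψ-measure, making ψ zero.
  have hconst : ∀ a ∈ A, ∀ b ∈ A, f a = f b := by
    intro a ha b hb
    by_contra hab
    refine hψ.1 (Measure.measure_univ_eq_zero.1 ?_)
    refine measure_mono_null ?_ (measure_union_null (hD a ha) (hD b hb))
    intro z _
    rw [← Set.compl_inter]
    rintro ⟨⟨-, h1⟩, -, h2⟩
    exact hab ((show f z = f a from h1).symm.trans h2)
  have hne : A.Nonempty := by
    by_contra! hA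
    have := hAS x
    rw [hA, Set.compl_empty, measure_univ] at this
    exact one_ne_zero this
  obtain ⟨a, ha⟩ := hne
  have hall : ∀ z, f z = f a := by
    intro z
    rw [← hSf, kernelOp_apply, hSf]
    have h1 : ∀ᵐ y ∂(S z), f y = f a := by
      filter_upwards [measure_eq_zero_iff_ae_notMem.1 (hAS z)] with y hy
      exact hconst y (by simpa using hy) a ha
    rw [integral_congr_ae h1]
    simp
  rw [hall x, hall y]

end Eigenfunctions

/-- When the powers of `P` converge to the projection onto the constants given by a probability
measure, that measure is the only invariant one. -/
theorem eq_of_invariant_of_tendsto {P : Kernel E E} [IsMarkovKernel P] {hP : ActsOn P w}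
    {S : Kernel E E} [IsMarkovKernel S] {hS : ActsOn S w}
    (hlim : Tendsto (fun n => kernelOp P w hP ^ n) atTop (𝓝 (kernelOp S w hS)))
    {π π' : Measure E} (hSπ : ∀ x, S x = π) [IsProbabilityMeasure π']
    (hinv : Kernel.Invariant P π') : π' = π := by
  have hpow : ∀ n, Kernel.Invariant (P ^ n) π' := by
    intro n
    induction n with
    | zero =>
      change π'.bind Kernel.id = π'
      exact Measure.id_comp
    | succ n ih => exact ih.comp hinv
  ext A hA
  -- By invariance the left-hand integrals all equal π'(A), while the limit is π(A).
  have h1 : Tendsto (fun n => ∫⁻ y, (P ^ n) y A ∂π') atTop (𝓝 (∫⁻ _, π A ∂π')) := by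
    refine tendsto_lintegral_of_dominated_convergence (fun _ => 1)
      (fun n => (P ^ n).measurable_coe hA) (fun n => Eventually.of_forall fun y => ?_)
      (by simp) (Eventually.of_forall fun y => ?_)
    · have := isMarkovKernel_pow P n
      exact prob_le_one
    · have h2 := (Complex.continuous_re.tendsto _).comp (tendsto_apply_apply hlim (ind w A hA) y)
      rw [kernelOp_ind_apply, hSπ] at h2
      have h3 := (ENNReal.continuous_ofReal.tendsto _).comp h2
      have : IsProbabilityMeasure π := hSπ y ▸ inferInstance
      rw [Complex.ofReal_re, measureReal_def, ENNReal.ofReal_toReal (measure_ne_top _ _)] at h3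
      refine h3.congr fun n => ?_
      have := isMarkovKernel_pow P n
      simp only [Function.comp_apply]
      rw [kernelOp_pow_ind_apply, Complex.ofReal_re, measureReal_def,
        ENNReal.ofReal_toReal (measure_ne_top _ _)]
  have h2 : ∀ n, ∫⁻ y, (P ^ n) y A ∂π' = π' A := fun n => by
    rw [← Measure.bind_apply hA (P ^ n).measurable.aemeasurable, (hpow n).def]
  simp only [h2] at h1
  have h3 := tendsto_nhds_unique h1 tendsto_const_nhds
  rw [← h3]
  simp

theorem invariant_of_kernelOp_mul_eq {P : Kernel E E} [IsMarkovKernel P] {hP : ActsOn P w}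
    {S : Kernel E E} [IsMarkovKernel S] {hS : ActsOn S w}
    (h : kernelOp S w hS * kernelOp P w hP = kernelOp S w hS) (x : E) :
    Kernel.Invariant P (S x) := by
  change (S x).bind P = S x
  have : IsProbabilityMeasure ((S x).bind P) :=
    (inferInstance : IsMarkovKernel (P ∘ₖ S)).isProbabilityMeasure x
  ext A hA
  have h1 : kernelOp S w hS (kernelOp P w hP (ind w A hA)) x = kernelOp S w hS (ind w A hA) x :=
    congrArg (fun f : WBounded w => f x) (DFunLike.congr_fun h (ind w A hA))
  rw [kernelOp_kernelOp_ind_apply, kernelOp_ind_apply] at h1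
  have h2 : ((P ∘ₖ S) x).real A = (S x).real A := by exact_mod_cast h1
  exact (measureReal_eq_measureReal_iff).1 h2

end QuasiCompactKernel

/-! ### The ergodic theorem -/

theorem mainTheorem7 {E : Type*} [MeasurableSpace E] (w : QuasiCompactKernel.Weight E)
    (P : Kernel E E) [IsMarkovKernel P] (hPw : QuasiCompactKernel.ActsOn P w)
    (hqc : QuasiCompactKernel.IsQuasiCompact (QuasiCompactKernel.kernelOp P w hPw)) :
    ∃ (d : ℕ) (S : Kernel E E) (hSw : QuasiCompactKernel.ActsOn S w) (C ρ : ℝ),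
      1 ≤ d ∧ IsMarkovKernel S ∧
      -- `S` has finite rank
      FiniteDimensional ℂ (QuasiCompactKernel.kernelOp S w hSw).range ∧
      -- `S(𝓑_w) ⊂ 𝓑`
      (∀ f : QuasiCompactKernel.WBounded w,
        ∃ M : ℝ, ∀ x, ‖QuasiCompactKernel.kernelOp S w hSw f x‖ ≤ M) ∧
      0 ≤ ρ ∧ ρ < 1 ∧
      (∀ k < d, ∀ n : ℕ,
        ‖QuasiCompactKernel.kernelOp P w hPw ^ (n * d + k) -
          QuasiCompactKernel.kernelOp P w hPw ^ k * QuasiCompactKernel.kernelOp S w hSw‖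
            ≤ C * ρ ^ n) ∧
      (∀ k < d, ∀ n : ℕ, ∀ (f : QuasiCompactKernel.WBounded w) (x : E),
        ‖(QuasiCompactKernel.kernelOp P w hPw ^ (n * d + k)) f x -
          (QuasiCompactKernel.kernelOp P w hPw ^ k) (QuasiCompactKernel.kernelOp S w hSw f) x‖
            ≤ C * ‖f‖ * ρ ^ n * w x) ∧
      (QuasiCompactKernel.IsIrreducibleKernel P → QuasiCompactKernel.IsAperiodicKernel P →
        d = 1 ∧
        ∃ π : Measure E, IsProbabilityMeasure π ∧ Kernel.Invariant P π ∧
          (∀ π' : Measure E, IsProbabilityMeasure π' → Kernel.Invariant P π' → π' = π) ∧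
          ∀ f : QuasiCompactKernel.WBounded w, Integrable (f : E → ℂ) π ∧
            ∀ x, QuasiCompactKernel.kernelOp S w hSw f x = ∫ y, f y ∂π) := by
  set T := QuasiCompactKernel.kernelOp P w hPw with hT
  obtain ⟨⟨M, hM⟩, L, φ, hφ, hlim, hLL, hfinL⟩ :=
    QuasiCompactKernel.exists_tendsto_kernelOp_pow_idempotent hPw hqc
  have hcL : T * L = L * T :=
    tendsto_nhds_unique (hlim.const_mul T) ((hlim.mul_const T).congr fun j => by
      rw [← pow_succ, ← pow_succ'])
  have hone : L (QuasiCompactKernel.WBounded.ind w Set.univ MeasurableSet.univ) =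
      QuasiCompactKernel.WBounded.ind w Set.univ MeasurableSet.univ := by
    have h1 := ((ContinuousLinearMap.apply ℂ (QuasiCompactKernel.WBounded w)
      (QuasiCompactKernel.WBounded.ind w Set.univ MeasurableSet.univ)).continuous.tendsto
        L).comp hlim
    refine tendsto_nhds_unique h1 (tendsto_const_nhds.congr fun j => ?_)
    have h2 := QuasiCompactKernel.pow_apply_of_eigenvector (μ := 1)
      (show T _ = (1 : ℂ) • _ by rw [one_smul]; exact QuasiCompactKernel.kernelOp_one hPw) (φ j)
    rw [one_pow, one_smul] at h2
    exact h2.symm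
  obtain ⟨S, hSw, hSM, rfl⟩ := QuasiCompactKernel.exists_markov_kernelOp_eq
    (QuasiCompactKernel.SigmaContinuous.of_tendsto
      (fun j => (QuasiCompactKernel.sigmaContinuous_kernelOp hPw).pow (φ j)) hlim)
    (QuasiCompactKernel.RePositive.of_tendsto
      (fun j => (QuasiCompactKernel.rePositive_kernelOp hPw).pow (φ j)) hlim) hone
  set L := QuasiCompactKernel.kernelOp S w hSw with hL
  have hLf : ∀ f, L (L f) = L f := fun f => DFunLike.congr_fun hLL f
  have hrange : ∀ v ∈ L.range, L v = v := by
    rintro _ ⟨g, rfl⟩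
    exact hLf g
  have hTrange : ∀ v ∈ L.range, T v ∈ L.range := by
    rintro _ ⟨g, rfl⟩
    exact ⟨T g, (DFunLike.congr_fun hcL g).symm⟩
  obtain ⟨C, ρ, hρ0, hρ1, hC⟩ := QuasiCompactKernel.exists_norm_pow_sub_le hφ hlim hLL hcL
  -- `d` is chosen before irreducibility and aperiodicity are assumed, hence the case distinction;
  -- aperiodicity alone already gives d = 1.
  obtain ⟨d, hd1, hd, hdap⟩ : ∃ d : ℕ, 1 ≤ d ∧ (∀ v ∈ L.range, (T ^ d) v = v) ∧
      (QuasiCompactKernel.IsAperiodicKernel P → d = 1) := by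
    by_cases hap : QuasiCompactKernel.IsAperiodicKernel P
    · exact ⟨1, le_rfl, QuasiCompactKernel.pow_apply_eq_self hTrange hM one_ne_zero
        fun μ v hv hv0 hμ => by
          rw [pow_one]
          exact QuasiCompactKernel.eigenvalue_eq_one_of_aperiodic hφ hlim hLL hcL hap hv0
            (hrange v hv) hμ, fun _ => rfl⟩
    · obtain ⟨d, hd1, hd⟩ := QuasiCompactKernel.exists_pow_apply_eq_self hTrange hM
        fun μ v hv hv0 hμ => QuasiCompactKernel.exists_pow_eigenvalue_eq_one hφ hlim hLL hcL hv0
          (hrange v hv) hμ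
      exact ⟨d, hd1, hd, fun h => absurd h hap⟩
  have hTd : T ^ d * L = L := ContinuousLinearMap.ext fun f => hd (L f) ⟨f, rfl⟩
  have hTnd : ∀ n : ℕ, T ^ (n * d) * L = L := by
    intro n
    induction n with
    | zero => simp
    | succ n ih => rw [Nat.succ_mul, pow_add, mul_assoc, hTd, ih]
  have hC0 : 0 ≤ C := by simpa using (norm_nonneg _).trans (hC 0)
  have hbound : ∀ k n : ℕ, ‖T ^ (n * d + k) - T ^ k * L‖ ≤ C * ρ ^ n := by
    intro k n
    -- Periodicity on the range of `L` reduces the claim to the decay of Tᵐ - TᵐL at m = nd + k,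
    -- which is at least n since d ≥ 1.
    have h1 : T ^ k * L = T ^ (n * d + k) * L := by
      rw [add_comm, pow_add, mul_assoc, hTnd]
    rw [h1]
    refine (hC _).trans (mul_le_mul_of_nonneg_left ?_ hC0)
    exact pow_le_pow_of_le_one hρ0 hρ1.le (by nlinarith)
  refine ⟨d, S, hSw, C, ρ, hd1, hSM, hfinL,
    fun f => QuasiCompactKernel.kernelOp_mem_boundedFunctions hSw f, hρ0, hρ1,
    fun k _ n => hbound k n, fun k _ n f x => ?_, fun hirr hap => ?_⟩
  · refine (QuasiCompactKernel.WBounded.norm_apply_le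
      ((T ^ (n * d + k) - T ^ k * L) f) x).trans (mul_le_mul_of_nonneg_right ?_ (w.pos x).le)
    refine ((T ^ (n * d + k) - T ^ k * L).le_opNorm f).trans ?_
    refine (mul_le_mul_of_nonneg_right (hbound k n) (norm_nonneg f)).trans_eq ?_
    ring
  · obtain rfl := hdap hap
    have hTL : T * L = L := by rwa [pow_one] at hTd
    have hconst : ∀ (f : QuasiCompactKernel.WBounded w) (x y : E), L f x = L f y := fun f =>
      QuasiCompactKernel.apply_eq_apply_of_irreducible hφ hlim hLL hcL hirr (hLf f)
        (DFunLike.congr_fun hTL f)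
    have hne : Nonempty E := by
      obtain ⟨ψ, hψ⟩ := hirr
      by_contra hE
      rw [not_nonempty_iff] at hE
      exact hψ.1 (Measure.eq_zero_of_isEmpty ψ)
    obtain ⟨x₀⟩ := hne
    have hSx : ∀ x, S x = S x₀ := by
      intro x
      ext A hA
      have h1 := hconst (QuasiCompactKernel.WBounded.ind w A hA) x x₀
      rw [hL, QuasiCompactKernel.kernelOp_ind_apply, QuasiCompactKernel.kernelOp_ind_apply] at h1
      have h2 : (S x).real A = (S x₀).real A := by exact_mod_cast h1
      exact (measureReal_eq_measureReal_iff).1 h2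
    have hTlim : Tendsto (fun n => T ^ n) atTop (𝓝 L) := by
      rw [tendsto_iff_norm_sub_tendsto_zero]
      refine squeeze_zero (fun _ => norm_nonneg _) (fun n => ?_)
        (by simpa using (tendsto_pow_atTop_nhds_zero_of_lt_one hρ0 hρ1).const_mul C)
      simpa using hbound 0 n
    refine ⟨rfl, S x₀, inferInstance,
      QuasiCompactKernel.invariant_of_kernelOp_mul_eq (hcL.symm.trans hTL) x₀,
      fun π' hπ' hinv => QuasiCompactKernel.eq_of_invariant_of_tendsto hTlim hSx hinv,
      fun f => ⟨hSw.integrable f x₀, fun x => ?_⟩⟩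
    rw [QuasiCompactKernel.kernelOp_apply, hSx x]
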